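/- Let $p\in(0,1)$ be fixed, independent of $n$. Let $G$ be a random graph in the Erdős–Rényi model $G_{n,p}$: it has vertex set $\{1,\dots,n\}$, and each pair of distinct vertices is joined by an edge independently with probability $p$. Let $d_i$ be the degree of vertex $i$ in $G$. Let $M_1(G)$ be the symmetric $n\times n$ matrix whose $(i,j)$ entry is $d_i+d_j$ if $ij\in E(G)$ and $0$ otherwise, and let $M_2(G)$ be the symmetric $n\times n$ matrix whose $(i,j)$ entry is $d_id_j$ if $ij\in E(G)$ and $0$ otherwise. For a real symmetric matrix $M$ with eigenvalues $\lambda_1,\dots,\lambda_n$ (with multiplicity) let $\mathcal E(M)=\sum_{i=1}^n|\lambda_i|$ be its energy. Then, for almost all graphs $G$ in $G_{n,p}$, $$\mathcal E(M_1(G))=(1+o(1))\,p\cdot\frac{16}{3\pi}\sqrt{p(1-p)}\cdot n^{5/2},\qquad \mathcal E(M_2(G))=(1+o(1))\,p^2\cdot\frac{8}{3\pi}\sqrt{p(1-p)}\cdot n^{7/2}.$$ That is, writing $X_n=p\,\frac{16}{3\pi}\sqrt{p(1-p)}\,n^{5/2}$ and $Y_n=p^2\,\frac{8}{3\pi}\sqrt{p(1-p)}\,n^{7/2}$,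 for every $\varepsilon>0$ the probability that both $|\mathcal E(M_1(G))-X_n|\le\varepsilon X_n$ and $|\mathcal E(M_2(G))-Y_n|\le\varepsilon Y_n$ hold tends to $1$ as $n\to\infty$. -/

import Mathlib

open Filter Topology

noncomputable section

/-- The energy of a real symmetric matrix: the sum of the absolute values of its eigenvalues,
counted with multiplicity. -/
def matrixEnergy {V : Type*} [Fintype V] [DecidableEq V] (A : Matrix V V ℝ)
    (hA : A.IsHermitian) : ℝ :=
  ∑ i, |hA.eigenvalues i|

open Classical in
/-- The adjacency matrix of `G` in which every edge `ij` carries the weight `f (d_i) (d_j)`,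
where `d_v` is the degree of the vertex `v` in `G`. -/
def degreeWeightedMatrix {V : Type*} [Fintype V] (f : ℝ → ℝ → ℝ) (G : SimpleGraph V) :
    Matrix V V ℝ :=
  Matrix.of fun i j => if G.Adj i j then f (G.degree i) (G.degree j) else 0

theorem degreeWeightedMatrix_isHermitian {V : Type*} [Fintype V] {f : ℝ → ℝ → ℝ}
    (hf : ∀ x y, f x y = f y x) (G : SimpleGraph V) :
    (degreeWeightedMatrix f G).IsHermitian := by
  ext i j
  by_cases h : G.Adj i j
  · simpa [degreeWeightedMatrix, h, h.symm] using hf _ _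
  · have h2 : ¬ G.Adj j i := fun h3 => h h3.symm
    simp [degreeWeightedMatrix, h, h2]

/-- The first Zagreb matrix: edge weights `d_i + d_j`. -/
def zagrebMatrix₁ {V : Type*} [Fintype V] (G : SimpleGraph V) : Matrix V V ℝ :=
  degreeWeightedMatrix (fun x y => x + y) G

/-- The second Zagreb matrix: edge weights `d_i * d_j`. -/
def zagrebMatrix₂ {V : Type*} [Fintype V] (G : SimpleGraph V) : Matrix V V ℝ :=
  degreeWeightedMatrix (fun x y => x * y) G

theorem zagrebMatrix₁_isHermitian {V : Type*} [Fintype V] (G : SimpleGraph V) :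
    (zagrebMatrix₁ G).IsHermitian :=
  degreeWeightedMatrix_isHermitian add_comm G

theorem zagrebMatrix₂_isHermitian {V : Type*} [Fintype V] (G : SimpleGraph V) :
    (zagrebMatrix₂ G).IsHermitian :=
  degreeWeightedMatrix_isHermitian mul_comm G

/-- Almost all graphs in the Erdős–Rényi model `G_{n,p}` have the property `Q`: the probability
that a random graph on `n` vertices, each edge present independently with probability `p`,
has `Q` tends to `1` as `n → ∞`. -/
def AlmostAllGraphs (p : unitInterval) (Q : ∀ n : ℕ, SimpleGraph (Fin n) → Prop) : Prop :=
  Tendsto (fun n : ℕ => SimpleGraph.binomialRandom (Fin n) p {G | Q n G}) atTop (𝓝 1)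

end

/-! The degrees in `G` concentrate around `np`, so the weight `f d_i d_j` is close to a constant
`c`, namely `2np` for the sum and `(np)²` for the product. With `W` the centered adjacency matrix
scaled by `1/√n`, the weighted matrix is `c√n W + cp(J - I) + R`, where `J` is the all-ones matrix
and `R` collects the degree fluctuations. Energy is the maximum of `tr (A S)` over symmetric `S` of
operator norm at most 1. Testing with one `S` on both sides shows that `J - I` costs at most `2cpn`
and that `R` costs at most `√n` times its Frobenius norm (`abs_matrixEnergy_sub_le`). Both are of
relative order `n^{-1/2}` against the main term `c n^{3/2}`, the second one in mean.

It remains to see that `E(W)/n` tends to `8/(3π) √q` with `q = p(1-p)`, which is the mean of `|x|`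
under the semicircle law of variance `q`. Coulson's formula writes `|x|` as `2/π` times the integral
of `x²/(x²+t²)` over `t > 0`, so only the normalized resolvent trace `s` at `z = it` is needed. It
nearly solves `1 + zs + qs² = 0`: the second moment of the defect is expanded entry by entry, each
edge being resampled with all others fixed (`norm_graphMean_entry_le`,
`graphMean_norm_quadraticDefect_sq_le`). The equation is stable on the imaginary axis
(`abs_eigenvalueProfile_sub_le`), which gives convergence in mean for each fixed `t`. Dominated
convergence in `t` gives convergence of the energy in mean, and Markov's inequality turns means into
probabilities. -/

open Matrix

/-! ### Energy as a dual norm, and its stability under perturbation. -/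

section Spectral

variable {V : Type*} [Fintype V] [DecidableEq V]

theorem Matrix.IsHermitian.exists_orthogonal_diagonalization {A : Matrix V V ℝ}
    (hA : A.IsHermitian) :
    ∃ U : Matrix V V ℝ, Uᵀ * U = 1 ∧ U * Uᵀ = 1 ∧ A = U * diagonal hA.eigenvalues * Uᵀ := by
  refine ⟨hA.eigenvectorUnitary, ?_, ?_, ?_⟩
  · have := Unitary.coe_star_mul_self hA.eigenvectorUnitary
    simpa [star_eq_conjTranspose, conjTranspose_eq_transpose_of_trivial] using this
  · have := Unitary.coe_mul_star_self hA.eigenvectorUnitary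
    simpa [star_eq_conjTranspose, conjTranspose_eq_transpose_of_trivial] using this
  · have := hA.spectral_theorem
    rw [Unitary.conjStarAlgAut_apply] at this
    simpa [star_eq_conjTranspose, conjTranspose_eq_transpose_of_trivial, Function.comp_def]
      using this

/-- The quadratic form of `S` is bounded by the standard one. -/
def IsFormContraction (S : Matrix V V ℝ) : Prop :=
  ∀ x : V → ℝ, |x ⬝ᵥ S *ᵥ x| ≤ x ⬝ᵥ x

/-- In an eigenbasis `u_k` of `B` the trace is the sum of `λ_k (u_k ⬝ S u_k)`, and each form value
has modulus at most 1. -/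
theorem trace_mul_le_matrixEnergy {B S : Matrix V V ℝ} (hB : B.IsHermitian)
    (hS : IsFormContraction S) : (B * S).trace ≤ matrixEnergy B hB := by
  obtain ⟨U, hU, -, hBU⟩ := hB.exists_orthogonal_diagonalization
  have h1 : (B * S).trace = ∑ k, hB.eigenvalues k * (Uᵀ * S * U) k k := by
    conv_lhs => rw [hBU]
    rw [Matrix.mul_assoc, Matrix.mul_assoc, Matrix.trace_mul_comm, Matrix.mul_assoc,
      Matrix.trace]
    simp [diagonal_mul]
  have h2 (k : V) : |(Uᵀ * S * U) k k| ≤ 1 := by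
    have h3 := hS (fun i => U i k)
    have h4 : (fun i => U i k) ⬝ᵥ S *ᵥ (fun i => U i k) = (Uᵀ * S * U) k k := by
      rw [Matrix.mul_assoc, Matrix.mul_apply]
      simp [dotProduct, mulVec, Matrix.mul_apply]
    have h5 : (fun i => U i k) ⬝ᵥ (fun i => U i k) = 1 := by
      have := congrFun (congrFun hU k) k
      simpa [Matrix.mul_apply, dotProduct] using this
    rwa [h4, h5] at h3
  rw [h1, matrixEnergy]
  refine Finset.sum_le_sum fun k _ => (le_abs_self _).trans ?_
  rw [abs_mul]
  exact mul_le_of_le_one_right (abs_nonneg _) (h2 k)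

/-- The maximizer is the matrix sign of `A`. Its squared Frobenius norm is the rank of `A`; this
extra bound is what allows Cauchy–Schwarz against a remainder that is small only in Frobenius norm.
-/
theorem exists_trace_mul_eq_matrixEnergy {A : Matrix V V ℝ} (hA : A.IsHermitian) :
    ∃ S : Matrix V V ℝ, IsFormContraction S ∧ (A * S).trace = matrixEnergy A hA ∧
      ∑ i, ∑ j, S i j ^ 2 ≤ Fintype.card V := by
  obtain ⟨U, hU, hU', hAU⟩ := hA.exists_orthogonal_diagonalization
  set d : V → ℝ := fun k => SignType.sign (hA.eigenvalues k) with hd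
  have hd1 (k : V) : |d k| ≤ 1 := by
    simp only [hd]
    rcases lt_trichotomy (hA.eigenvalues k) 0 with h | h | h <;> simp [h]
  refine ⟨U * diagonal d * Uᵀ, ?_, ?_, ?_⟩
  · intro x
    have h1 : x ⬝ᵥ (U * diagonal d * Uᵀ) *ᵥ x = ∑ k, d k * (Uᵀ *ᵥ x) k ^ 2 := by
      rw [← mulVec_mulVec, ← mulVec_mulVec, dotProduct_mulVec, ← mulVec_transpose, dotProduct]
      refine Finset.sum_congr rfl fun k _ => ?_
      rw [mulVec_diagonal]; ring
    have h2 : x ⬝ᵥ x = ∑ k, (Uᵀ *ᵥ x) k ^ 2 := by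
      have : x ⬝ᵥ x = x ⬝ᵥ (U * Uᵀ) *ᵥ x := by rw [hU', one_mulVec]
      rw [this, ← mulVec_mulVec, dotProduct_mulVec, ← mulVec_transpose, dotProduct]
      exact Finset.sum_congr rfl fun k _ => by ring
    rw [h1, h2]
    refine (Finset.abs_sum_le_sum_abs _ _).trans (Finset.sum_le_sum fun k _ => ?_)
    rw [abs_mul, abs_of_nonneg (sq_nonneg ((Uᵀ *ᵥ x) k))]
    exact mul_le_of_le_one_left (sq_nonneg _) (hd1 k)
  · have h1 : A * (U * diagonal d * Uᵀ) =
        U * (diagonal hA.eigenvalues * diagonal d) * Uᵀ := by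
      conv_lhs => rw [hAU]
      calc _ = U * diagonal hA.eigenvalues * (Uᵀ * U) * diagonal d * Uᵀ := by
            simp only [Matrix.mul_assoc]
        _ = _ := by rw [hU, Matrix.mul_one]; simp only [Matrix.mul_assoc]
    rw [h1, Matrix.trace_mul_comm, ← Matrix.mul_assoc, hU, Matrix.one_mul, diagonal_mul_diagonal,
      trace_diagonal, matrixEnergy]
    refine Finset.sum_congr rfl fun k _ => ?_
    simp [hd]
  · have h1 : ∑ i, ∑ j, (U * diagonal d * Uᵀ) i j ^ 2 =
        ((U * diagonal d * Uᵀ) * (U * diagonal d * Uᵀ)ᵀ).trace := by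
      generalize U * diagonal d * Uᵀ = S
      simp [Matrix.trace, Matrix.mul_apply, sq]
    have h2 : (U * diagonal d * Uᵀ) * (U * diagonal d * Uᵀ)ᵀ =
        U * (diagonal d * diagonal d) * Uᵀ := by
      rw [transpose_mul, transpose_mul, transpose_transpose, diagonal_transpose]
      calc _ = U * diagonal d * (Uᵀ * U) * diagonal d * Uᵀ := by
            simp only [Matrix.mul_assoc]
        _ = _ := by rw [hU, Matrix.mul_one]; simp only [Matrix.mul_assoc]
    rw [h1, h2, Matrix.trace_mul_comm, ← Matrix.mul_assoc, hU, Matrix.one_mul,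
      diagonal_mul_diagonal, trace_diagonal, Fintype.card, Finset.cast_card]
    refine Finset.sum_le_sum fun k _ => ?_
    nlinarith [abs_le.1 (hd1 k)]

/-- The error terms in the comparison of energies, tested against a contraction. -/
theorem abs_trace_mul_le {S R : Matrix V V ℝ} (hS : IsFormContraction S)
    (hS2 : ∑ i, ∑ j, S i j ^ 2 ≤ Fintype.card V) (a b : ℝ) :
    |((a • (of fun _ _ => (1 : ℝ)) + b • (1 : Matrix V V ℝ) + R) * S).trace| ≤
      |a| * Fintype.card V + |b| * Fintype.card V +
        √(Fintype.card V * ∑ i, ∑ j, R i j ^ 2) := by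
  have hJ : |((of fun _ _ => (1 : ℝ) : Matrix V V ℝ) * S).trace| ≤ Fintype.card V := by
    have := hS (fun _ => 1)
    have h2 : ((of fun _ _ => (1 : ℝ) : Matrix V V ℝ) * S).trace =
        (fun _ => 1) ⬝ᵥ S *ᵥ (fun _ => 1) := by
      simp only [Matrix.trace, diag_apply, Matrix.mul_apply, of_apply, one_mul, dotProduct, mulVec,
        mul_one]
      exact Finset.sum_comm
    rw [h2]
    simpa [dotProduct] using this
  have hI : |((1 : Matrix V V ℝ) * S).trace| ≤ Fintype.card V := by
    rw [Matrix.one_mul, Matrix.trace, Fintype.card, Finset.cast_card]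
    refine (Finset.abs_sum_le_sum_abs _ _).trans (Finset.sum_le_sum fun k _ => ?_)
    simpa using hS (Pi.single k 1)
  have hR : |(R * S).trace| ≤ √(Fintype.card V * ∑ i, ∑ j, R i j ^ 2) := by
    apply Real.abs_le_sqrt
    have h1 : (R * S).trace = ∑ x : V × V, R x.1 x.2 * S x.2 x.1 := by
      rw [Fintype.sum_prod_type]
      simp [Matrix.trace, Matrix.mul_apply]
    have h2 : ∑ x : V × V, S x.2 x.1 ^ 2 = ∑ i, ∑ j, S i j ^ 2 := by
      rw [Fintype.sum_prod_type, Finset.sum_comm]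
    rw [h1]
    refine (Finset.sum_mul_sq_le_sq_mul_sq _ _ _).trans ?_
    rw [h2, Fintype.sum_prod_type, mul_comm]
    gcongr
  rw [Matrix.add_mul, Matrix.add_mul, trace_add, trace_add, smul_mul, smul_mul, trace_smul,
    trace_smul, smul_eq_mul, smul_eq_mul]
  refine (abs_add_three _ _ _).trans ?_
  rw [abs_mul, abs_mul]
  gcongr

/-- Each inequality tests both matrices with the sign matrix of one of them: it is optimal for that
one and admissible for the other, so only the trace against the difference remains. -/
theorem abs_matrixEnergy_sub_le {M W R : Matrix V V ℝ} (hM : M.IsHermitian) (hW : W.IsHermitian)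
    {a b c : ℝ} (hc : 0 ≤ c)
    (h : M = c • W + (a • (of fun _ _ => (1 : ℝ)) + b • (1 : Matrix V V ℝ) + R)) :
    |matrixEnergy M hM - c * matrixEnergy W hW| ≤
      |a| * Fintype.card V + |b| * Fintype.card V +
        √(Fintype.card V * ∑ i, ∑ j, R i j ^ 2) := by
  have h3 (S : Matrix V V ℝ) : (M * S).trace = c * (W * S).trace +
      ((a • (of fun _ _ => (1 : ℝ)) + b • (1 : Matrix V V ℝ) + R) * S).trace := by
    conv_lhs => rw [h]
    rw [Matrix.add_mul, trace_add, smul_mul, trace_smul, smul_eq_mul]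
  rw [abs_le]
  constructor
  · obtain ⟨S, hS, hWS, hS2⟩ := exists_trace_mul_eq_matrixEnergy hW
    have h1 := trace_mul_le_matrixEnergy hM hS
    have h2 := (abs_le.1 (abs_trace_mul_le (R := R) hS hS2 a b)).1
    rw [h3, hWS] at h1
    linarith
  · obtain ⟨S, hS, hMS, hS2⟩ := exists_trace_mul_eq_matrixEnergy hM
    have h1 := mul_le_mul_of_nonneg_left (trace_mul_le_matrixEnergy hW hS) hc
    have h2 := (abs_le.1 (abs_trace_mul_le (R := R) hS hS2 a b)).2
    rw [← hMS, h3]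
    linarith

end Spectral
-- Resolvents on the imaginary axis.
section Resolvent

variable {V : Type*} [Fintype V] [DecidableEq V]

/-- The complex matrix `H - it`. -/
noncomputable def imShift (H : Matrix V V ℝ) (t : ℝ) : Matrix V V ℂ :=
  H.map Complex.ofRealHom - (t * Complex.I) • (1 : Matrix V V ℂ)

/-- The resolvent `(H - it)⁻¹` of a real matrix at the point `it` of the imaginary axis. -/
noncomputable def imResolvent (H : Matrix V V ℝ) (t : ℝ) : Matrix V V ℂ :=
  (imShift H t)⁻¹

theorem ofReal_sub_mul_I_ne_zero (x : ℝ) {t : ℝ} (ht : 0 < t) :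
    (x : ℂ) - t * Complex.I ≠ 0 := by
  intro h
  have := congrArg Complex.im h
  simp at this
  exact ht.ne' this

theorem imShift_mul_diagonalized {H U : Matrix V V ℝ} {x : V → ℝ} {t : ℝ} (ht : 0 < t)
    (hU : Uᵀ * U = 1) (hU' : U * Uᵀ = 1) (hH : H = U * diagonal x * Uᵀ) :
    imShift H t * (U.map Complex.ofRealHom *
      diagonal (fun k => ((x k : ℂ) - t * Complex.I)⁻¹) * (U.map Complex.ofRealHom)ᵀ) = 1 := by
  set Y := U.map Complex.ofRealHom with hY
  have hY1 : Yᵀ * Y = 1 := by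
    have := congrArg (fun M : Matrix V V ℝ => M.map Complex.ofRealHom) hU
    simpa [Matrix.map_mul, transpose_map, hY] using this
  have hY2 : Y * Yᵀ = 1 := by
    have := congrArg (fun M : Matrix V V ℝ => M.map Complex.ofRealHom) hU'
    simpa [Matrix.map_mul, transpose_map, hY] using this
  have hS : imShift H t = Y * diagonal (fun k => (x k : ℂ) - t * Complex.I) * Yᵀ := by
    have h1 : diagonal (fun k => (x k : ℂ) - t * Complex.I) =
        diagonal (fun k => (x k : ℂ)) - (t * Complex.I) • (1 : Matrix V V ℂ) := by
      ext i j
      by_cases h : i = j <;> simp [h, diagonal]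
    rw [imShift, hH, h1, Matrix.mul_sub, Matrix.sub_mul, Matrix.mul_smul, Matrix.smul_mul,
      Matrix.mul_one, hY2, Matrix.map_mul, Matrix.map_mul, ← hY, diagonal_map (map_zero _)]
    rfl
  rw [hS]
  calc _ = Y * (diagonal (fun k => (x k : ℂ) - t * Complex.I) * (Yᵀ * Y) *
        diagonal (fun k => ((x k : ℂ) - t * Complex.I)⁻¹)) * Yᵀ := by
        simp only [Matrix.mul_assoc]
    _ = 1 := by
        rw [hY1, Matrix.mul_one, diagonal_mul_diagonal]
        simp only [mul_inv_cancel₀ (ofReal_sub_mul_I_ne_zero _ ht), diagonal_one, Matrix.mul_one,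
          hY2]

theorem trace_imResolvent {H U : Matrix V V ℝ} {x : V → ℝ} {t : ℝ} (ht : 0 < t)
    (hU : Uᵀ * U = 1) (hU' : U * Uᵀ = 1) (hH : H = U * diagonal x * Uᵀ) :
    (imResolvent H t).trace = ∑ k, ((x k : ℂ) - t * Complex.I)⁻¹ := by
  have hY1 : (U.map Complex.ofRealHom)ᵀ * U.map Complex.ofRealHom = 1 := by
    have := congrArg (fun M : Matrix V V ℝ => M.map Complex.ofRealHom) hU
    simpa [Matrix.map_mul, transpose_map] using this
  rw [imResolvent, Matrix.inv_eq_right_inv (imShift_mul_diagonalized ht hU hU' hH),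
    Matrix.trace_mul_comm, ← Matrix.mul_assoc, hY1, Matrix.one_mul, trace_diagonal]

theorem imShift_mul_imResolvent {H : Matrix V V ℝ} (hH : H.IsHermitian) {t : ℝ} (ht : 0 < t) :
    imShift H t * imResolvent H t = 1 := by
  obtain ⟨U, hU, hU', hA⟩ := hH.exists_orthogonal_diagonalization
  have h := imShift_mul_diagonalized ht hU hU' hA
  rw [imResolvent, Matrix.inv_eq_right_inv h, h]

theorem imResolvent_mul_imShift {H : Matrix V V ℝ} (hH : H.IsHermitian) {t : ℝ} (ht : 0 < t) :
    imResolvent H t * imShift H t = 1 :=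
  mul_eq_one_comm.1 (imShift_mul_imResolvent hH ht)

theorem imResolvent_transpose {H : Matrix V V ℝ} (hH : H.IsHermitian) (t : ℝ) :
    (imResolvent H t)ᵀ = imResolvent H t := by
  have h : Hᵀ = H := by rw [← conjTranspose_eq_transpose_of_trivial]; exact hH
  rw [imResolvent, transpose_nonsing_inv, imShift, transpose_sub, transpose_smul, transpose_one,
    ← transpose_map, h]

theorem imResolvent_comm {H : Matrix V V ℝ} (hH : H.IsHermitian) (t : ℝ) (i j : V) :
    imResolvent H t i j = imResolvent H t j i :=
  congrFun (congrFun (imResolvent_transpose hH t) j) i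

/-- The Ward identity. -/
theorem imResolvent_im_diag {H : Matrix V V ℝ} (hH : H.IsHermitian) {t : ℝ} (ht : 0 < t) (i : V) :
    (imResolvent H t i i).im = t * ∑ j, ‖imResolvent H t j i‖ ^ 2 := by
  set R := imResolvent H t with hR
  have h1 : Rᴴ * (imShift H t)ᴴ = 1 := by
    rw [← conjTranspose_mul, imShift_mul_imResolvent hH ht, conjTranspose_one]
  have h2 : (imShift H t)ᴴ = imShift H t + (2 * (t * Complex.I)) • (1 : Matrix V V ℂ) := by
    ext a b
    have := hH.apply a b
    by_cases h : a = b
    · subst h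
      simp [imShift]
      ring
    · simp only [star_trivial] at this
      simp [imShift, h, Ne.symm h, this]
  have h3 : R = Rᴴ + (2 * (t * Complex.I)) • (Rᴴ * R) := by
    calc R = Rᴴ * (imShift H t)ᴴ * R := by rw [h1, Matrix.one_mul]
      _ = Rᴴ * (imShift H t * R) + (2 * (t * Complex.I)) • (Rᴴ * R) := by
        rw [h2, Matrix.mul_add, Matrix.add_mul, Matrix.mul_smul, Matrix.smul_mul, Matrix.mul_one,
          Matrix.mul_assoc]
      _ = _ := by rw [imShift_mul_imResolvent hH ht, Matrix.mul_one]
  have h4 := congrArg Complex.im (congrFun (congrFun h3 i) i)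
  have h5 : (Rᴴ * R) i i = ((∑ j, ‖R j i‖ ^ 2 : ℝ) : ℂ) := by
    rw [Matrix.mul_apply]
    push_cast
    refine Finset.sum_congr rfl fun j _ => ?_
    rw [conjTranspose_apply, Complex.star_def, Complex.conj_mul']
  rw [Matrix.add_apply, Matrix.smul_apply, h5, conjTranspose_apply] at h4
  generalize ∑ j, ‖R j i‖ ^ 2 = T at h4 ⊢
  simp only [smul_eq_mul, Complex.add_im, Complex.star_def, Complex.conj_im, Complex.mul_im,
    Complex.mul_re, Complex.ofReal_re, Complex.ofReal_im, Complex.I_re, Complex.I_im,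
    Complex.re_ofNat, Complex.im_ofNat] at h4
  linarith

/-- With `T` the squared norm of column `i`, the Ward identity gives `tT = Im R_ii ≤ |R_ii| ≤ √T`,
hence `t²T ≤ 1`. -/
theorem sum_norm_sq_imResolvent_le {H : Matrix V V ℝ} (hH : H.IsHermitian) {t : ℝ} (ht : 0 < t)
    (i : V) : ∑ j, ‖imResolvent H t j i‖ ^ 2 ≤ (1 / t) ^ 2 := by
  have h1 := imResolvent_im_diag hH ht i
  set T := ∑ j, ‖imResolvent H t j i‖ ^ 2 with hT
  have h2 : ‖imResolvent H t i i‖ ^ 2 ≤ T :=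
    Finset.single_le_sum (f := fun j => ‖imResolvent H t j i‖ ^ 2) (fun _ _ => sq_nonneg _)
      (Finset.mem_univ i)
  have h3 : t * T ≤ ‖imResolvent H t i i‖ :=
    h1.symm.le.trans ((le_abs_self _).trans (Complex.abs_im_le_norm _))
  have hT0 : 0 ≤ T := Finset.sum_nonneg fun _ _ => sq_nonneg _
  clear_value T
  have h4 : (t * T) ^ 2 ≤ T := (pow_le_pow_left₀ (mul_nonneg ht.le hT0) h3 2).trans h2
  rcases hT0.eq_or_lt with h | h
  · rw [← h]; positivity
  · rw [div_pow, one_pow, le_div_iff₀ (by positivity)]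
    have : T * (T * t ^ 2) ≤ T * 1 := by nlinarith
    exact le_of_mul_le_mul_left this h

theorem norm_imResolvent_le {H : Matrix V V ℝ} (hH : H.IsHermitian) {t : ℝ} (ht : 0 < t)
    (i j : V) : ‖imResolvent H t i j‖ ≤ 1 / t := by
  have h2 : ‖imResolvent H t i j‖ ^ 2 ≤ ∑ k, ‖imResolvent H t k j‖ ^ 2 :=
    Finset.single_le_sum (f := fun k => ‖imResolvent H t k j‖ ^ 2) (fun _ _ => sq_nonneg _)
      (Finset.mem_univ i)
  exact le_of_sq_le_sq (h2.trans (sum_norm_sq_imResolvent_le hH ht j)) (by positivity)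

/-- The effect on the resolvent of changing one off-diagonal pair of entries. -/
theorem imResolvent_sub_apply {H H' : Matrix V V ℝ} (hH : H.IsHermitian) (hH' : H'.IsHermitian)
    {t : ℝ} (ht : 0 < t) {i j : V} {h : ℝ}
    (hd : H - H' = h • (single i j 1 + single j i 1)) (k l : V) :
    imResolvent H t k l - imResolvent H' t k l =
      -(h * (imResolvent H' t k i * imResolvent H t j l +
        imResolvent H' t k j * imResolvent H t i l)) := by
  set R := imResolvent H t
  set R' := imResolvent H' t
  have h1 : imShift H t - imShift H' t =
      (h : ℂ) • (single i j (1 : ℂ) + single j i (1 : ℂ)) := by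
    ext a b
    have := congrArg (fun z : ℝ => (z : ℂ)) (congrFun (congrFun hd a) b)
    simp only [Matrix.sub_apply, Matrix.smul_apply, Matrix.add_apply, smul_eq_mul,
      single_apply] at this
    simp only [imShift, Matrix.sub_apply, Matrix.map_apply, Matrix.smul_apply, Matrix.add_apply,
      smul_eq_mul, single_apply, Complex.ofRealHom_eq_coe]
    push_cast [apply_ite Complex.ofReal] at this
    linear_combination this
  -- The resolvent identity. It is kept exact, with one factor from each resolvent, so that it can
  -- be iterated to any order.
  have h2 : R - R' = -(R' * (imShift H t - imShift H' t) * R) := by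
    rw [Matrix.mul_sub, Matrix.sub_mul, imResolvent_mul_imShift hH' ht, Matrix.mul_assoc,
      imShift_mul_imResolvent hH ht, Matrix.mul_one, Matrix.one_mul, neg_sub]
  have h3 := congrFun (congrFun h2 k) l
  rw [h1, Matrix.mul_smul, Matrix.smul_mul, Matrix.mul_add, Matrix.add_mul] at h3
  rw [← Matrix.sub_apply, h3]
  have key (a b : V) : (R' * single a b (1 : ℂ) * R) k l = R' k a * R b l := by
    simp [Matrix.mul_apply, single_apply, Finset.sum_ite_eq, ite_and]
  rw [Matrix.neg_apply, Matrix.smul_apply, Matrix.add_apply, key, key, smul_eq_mul]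

end Resolvent
-- Expectations over the binomial random graph as finite sums.
section GraphMean

variable {V : Type*} [Fintype V] [DecidableEq V]

/-- The expectation of `f G` for a binomial random graph `G`. -/
noncomputable def graphMean (p : unitInterval) {E : Type*} [AddCommGroup E] [Module ℝ E]
    (f : SimpleGraph V → E) : E :=
  ∑ G, (SimpleGraph.binomialRandom V p).real {G} • f G

variable {p : unitInterval} {E : Type*} [AddCommGroup E] [Module ℝ E]

theorem graphMean_add (f g : SimpleGraph V → E) :
    graphMean p (fun G => f G + g G) = graphMean p f + graphMean p g := by
  simp [graphMean, Finset.sum_add_distrib]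

theorem graphMean_sub (f g : SimpleGraph V → E) :
    graphMean p (fun G => f G - g G) = graphMean p f - graphMean p g := by
  simp [graphMean, smul_sub]

theorem graphMean_sum {ι : Type*} (s : Finset ι) (f : ι → SimpleGraph V → E) :
    graphMean p (fun G => ∑ i ∈ s, f i G) = ∑ i ∈ s, graphMean p (f i) := by
  simp only [graphMean, Finset.smul_sum]
  exact Finset.sum_comm

theorem graphMean_const_mul {𝕜 : Type*} [Field 𝕜] [Algebra ℝ 𝕜] (c : 𝕜) (f : SimpleGraph V → 𝕜) :
    graphMean p (fun G => c * f G) = c * graphMean p f := by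
  simp [graphMean, Finset.mul_sum]

instance : MeasurableSingletonClass (SimpleGraph V) where
  measurableSet_singleton G := by
    refine ⟨{G.Adj}, measurableSet_singleton _, ?_⟩
    ext G'
    simp

theorem sum_binomialRandom_real_singleton (p : unitInterval) :
    ∑ G : SimpleGraph V, (SimpleGraph.binomialRandom V p).real {G} = 1 := by
  rw [MeasureTheory.sum_measureReal_singleton]
  simp

theorem graphMean_const (c : E) : graphMean p (fun _ : SimpleGraph V => c) = c := by
  rw [graphMean, ← Finset.sum_smul, sum_binomialRandom_real_singleton, one_smul]

theorem graphMean_mono {f g : SimpleGraph V → ℝ} (h : ∀ G, f G ≤ g G) :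
    graphMean p f ≤ graphMean p g :=
  Finset.sum_le_sum fun G _ => mul_le_mul_of_nonneg_left (h G) MeasureTheory.measureReal_nonneg

theorem graphMean_le_of_le {f : SimpleGraph V → ℝ} {c : ℝ} (h : ∀ G, f G ≤ c) :
    graphMean p f ≤ c :=
  (graphMean_mono h).trans_eq (graphMean_const c)

theorem graphMean_nonneg {f : SimpleGraph V → ℝ} (h : ∀ G, 0 ≤ f G) : 0 ≤ graphMean p f :=
  Finset.sum_nonneg fun G _ => mul_nonneg MeasureTheory.measureReal_nonneg (h G)

theorem norm_graphMean_le {F : Type*} [NormedAddCommGroup F] [NormedSpace ℝ F]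
    (f : SimpleGraph V → F) : ‖graphMean p f‖ ≤ graphMean p (fun G => ‖f G‖) := by
  refine (norm_sum_le _ _).trans_eq (Finset.sum_congr rfl fun G _ => ?_)
  rw [norm_smul, Real.norm_of_nonneg MeasureTheory.measureReal_nonneg, smul_eq_mul]

theorem graphMean_ofReal (f : SimpleGraph V → ℝ) :
    graphMean p (fun G => (f G : ℂ)) = ((graphMean p f : ℝ) : ℂ) := by
  simp [graphMean]

theorem graphMean_sq_le (f : SimpleGraph V → ℝ) :
    graphMean p f ^ 2 ≤ graphMean p (fun G => f G ^ 2) := by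
  have h : 0 ≤ graphMean p (fun G => (f G - graphMean p f) ^ 2) :=
    graphMean_nonneg fun G => sq_nonneg _
  have h2 (G : SimpleGraph V) : (f G - graphMean p f) ^ 2 =
      f G ^ 2 - (2 * graphMean p f * f G - graphMean p f ^ 2) := by ring
  simp only [h2, graphMean_sub, graphMean_const_mul, graphMean_const] at h
  linarith

theorem binomialRandom_real_le_graphMean_div {f : SimpleGraph V → ℝ} (hf : ∀ G, 0 ≤ f G) {a : ℝ}
    (ha : 0 < a) :
    (SimpleGraph.binomialRandom V p).real {G | a < f G} ≤ graphMean p f / a := by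
  classical
  have h1 : ({G | a < f G} : Set (SimpleGraph V)) =
      ((Finset.univ.filter fun G => a < f G : Finset (SimpleGraph V)) : Set (SimpleGraph V)) := by
    ext; simp
  rw [h1, ← MeasureTheory.sum_measureReal_singleton, le_div_iff₀ ha, Finset.sum_mul, graphMean]
  refine (Finset.sum_le_sum fun G hG => ?_).trans
    (Finset.sum_le_sum_of_subset_of_nonneg (Finset.filter_subset (fun G => a < f G) _)
      fun G _ _ => mul_nonneg MeasureTheory.measureReal_nonneg (hf G))
  exact mul_le_mul_of_nonneg_left (Finset.mem_filter.1 hG).2.le MeasureTheory.measureReal_nonneg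

/-- Adding an edge trades one factor `1 - p` for one factor `p`. The form without division needs no
assumption that `p` avoids 0 and 1. -/
theorem binomialRandom_real_sup_edge (p : unitInterval) {i j : V} (hij : i ≠ j)
    {G : SimpleGraph V} (hG : ¬G.Adj i j) :
    (1 - p : ℝ) * (SimpleGraph.binomialRandom V p).real {G ⊔ SimpleGraph.edge i j} =
      p * (SimpleGraph.binomialRandom V p).real {G} := by
  have h1 : (G ⊔ SimpleGraph.edge i j).edgeSet.ncard = G.edgeSet.ncard + 1 := by
    rw [SimpleGraph.edgeSet_sup, SimpleGraph.edgeSet_edge_of_ne hij, Set.union_singleton,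
      Set.ncard_insert_of_notMem (by simpa using hG) (Set.toFinite _)]
  have h2 : G.edgeSet.ncard + 1 ≤ (Nat.card V).choose 2 := by
    rw [← h1]
    classical
    rw [← SimpleGraph.coe_edgeFinset, Set.ncard_coe_finset, Nat.card_eq_fintype_card]
    exact SimpleGraph.card_edgeFinset_le_card_choose_two
  obtain ⟨m, hm⟩ := Nat.exists_eq_add_of_le h2
  simp only [MeasureTheory.measureReal_def, SimpleGraph.binomialRandom_singleton, h1, hm]
  rw [show G.edgeSet.ncard + 1 + m - (G.edgeSet.ncard + 1) = m by omega,
    show G.edgeSet.ncard + 1 + m - G.edgeSet.ncard = m + 1 by omega]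
  simp
  ring

/-- Resampling the pair `ij` does not change the expectation. -/
theorem graphMean_resample (f : SimpleGraph V → E) {i j : V} (hij : i ≠ j) :
    graphMean p f = graphMean p fun G =>
      (1 - p : ℝ) • f (G \ SimpleGraph.edge i j) + (p : ℝ) • f (G ⊔ SimpleGraph.edge i j) := by
  classical
  set e := SimpleGraph.edge i j with he
  have hadj : e.Adj i j := by simp [he, SimpleGraph.edge_adj, hij]
  have hle {G : SimpleGraph V} (hG : G.Adj i j) : e ≤ G := by
    rw [he, SimpleGraph.edge_le_iff]; exact Or.inr hG
  have hdis {G : SimpleGraph V} (hG : ¬G.Adj i j) : Disjoint G e := by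
    rw [he, SimpleGraph.disjoint_edge]; exact hG
  -- Graphs are paired as `G` and `G ⊔ e`, with `G` not containing the edge; within each pair the
  -- claim is the weight relation of `binomialRandom_real_sup_edge`.
  have split (g : SimpleGraph V → E) : ∑ G, g G =
      ∑ G with ¬G.Adj i j, (g G + g (G ⊔ e)) := by
    rw [← Finset.sum_filter_add_sum_filter_not _ (fun G : SimpleGraph V => ¬G.Adj i j),
      Finset.sum_add_distrib]
    congr 1
    refine Finset.sum_bij' (fun G _ => G \ e) (fun G _ => G ⊔ e) ?_ ?_ ?_ ?_ ?_
    · intro G _; simp [hadj]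
    · intro G _; simp [hadj]
    · intro G hG; exact sdiff_sup_cancel (hle (by simpa using hG))
    · intro G hG
      rw [sup_sdiff_right_self]
      exact (hdis (by simpa using hG)).sdiff_eq_left
    · intro G hG; rw [sdiff_sup_cancel (hle (by simpa using hG))]
  rw [graphMean, graphMean, split, split]
  refine Finset.sum_congr rfl fun G hG => ?_
  have hG : ¬G.Adj i j := by simpa using hG
  have h1 : (G ⊔ e) \ e = G := by
    rw [sup_sdiff_right_self]; exact (hdis hG).sdiff_eq_left
  have h2 := binomialRandom_real_sup_edge p hij hG
  rw [h1, (hdis hG).sdiff_eq_left, sup_assoc, sup_idem, ← he] at *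
  simp only [smul_add, smul_smul]
  generalize (SimpleGraph.binomialRandom V p).real {G} = a at *
  generalize (SimpleGraph.binomialRandom V p).real {G ⊔ e} = b at *
  rw [add_add_add_comm, ← add_smul, ← add_smul]
  congr 2
  · linear_combination -h2
  · linear_combination h2

end GraphMean
-- The centered adjacency matrix and independence of one entry from the others.
section CenteredMatrix

variable {V : Type*} [Fintype V] [DecidableEq V]

open Classical in
/-- The adjacency matrix with its off-diagonal entries centered, divided by `√|V|`. -/
noncomputable def normalizedMatrix (p : ℝ) (G : SimpleGraph V) : Matrix V V ℝ :=
  of fun i j => if i = j then 0 else ((if G.Adj i j then 1 else 0) - p) / √(Fintype.card V)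

theorem normalizedMatrix_isHermitian (p : ℝ) (G : SimpleGraph V) :
    (normalizedMatrix p G).IsHermitian := by
  ext i j
  by_cases h : G.Adj i j
  · simp [normalizedMatrix, eq_comm (a := j) (b := i), h, h.symm]
  · have h' : ¬G.Adj j i := fun h' => h h'.symm
    simp [normalizedMatrix, eq_comm (a := j) (b := i), h, h']

theorem abs_normalizedMatrix_le (p : unitInterval) (G : SimpleGraph V) (i j : V) :
    |normalizedMatrix p G i j| ≤ 1 / √(Fintype.card V) := by
  have h0 := p.2.1
  have h1 := p.2.2
  simp only [normalizedMatrix, of_apply]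
  split_ifs
  · simp
  all_goals
    rw [abs_div, abs_of_nonneg (Real.sqrt_nonneg _)]
    gcongr
    rw [abs_le]
    constructor <;> linarith

theorem normalizedMatrix_sdiff_edge (p : ℝ) (G : SimpleGraph V) {i j : V} (hij : i ≠ j) :
    normalizedMatrix p (G \ SimpleGraph.edge i j) i j = -p / √(Fintype.card V) := by
  simp [normalizedMatrix, hij, SimpleGraph.edge_adj]

theorem normalizedMatrix_sup_edge (p : ℝ) (G : SimpleGraph V) {i j : V} (hij : i ≠ j) :
    normalizedMatrix p (G ⊔ SimpleGraph.edge i j) i j = (1 - p) / √(Fintype.card V) := by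
  simp [normalizedMatrix, hij, SimpleGraph.edge_adj]

/-- `normalizedMatrix p G` with the entries `ij` and `ji` set to zero. -/
noncomputable def erasedMatrix (p : ℝ) (i j : V) (G : SimpleGraph V) : Matrix V V ℝ :=
  normalizedMatrix p G - normalizedMatrix p G i j • (single i j 1 + single j i 1)

theorem erasedMatrix_isHermitian (p : ℝ) (i j : V) (G : SimpleGraph V) :
    (erasedMatrix p i j G).IsHermitian := by
  refine (normalizedMatrix_isHermitian p G).sub ?_
  ext a b
  simp only [conjTranspose_apply, Matrix.smul_apply, Matrix.add_apply, single_apply,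
    smul_eq_mul, star_trivial]
  rw [add_comm]
  simp only [and_comm]

/-- This expresses independence: any function of the erased matrix is unaffected by resampling the
pair `ij`, and so qualifies as the factor `F` in the two moment identities below. -/
theorem erasedMatrix_resample (p : ℝ) {i j : V} (hij : i ≠ j) (G : SimpleGraph V) :
    erasedMatrix p i j (G \ SimpleGraph.edge i j) =
      erasedMatrix p i j (G ⊔ SimpleGraph.edge i j) := by
  ext a b
  simp only [erasedMatrix, Matrix.sub_apply, Matrix.smul_apply, Matrix.add_apply, single_apply,
    smul_eq_mul, normalizedMatrix_sdiff_edge p G hij, normalizedMatrix_sup_edge p G hij]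
  by_cases h1 : i = a ∧ j = b
  · obtain ⟨rfl, rfl⟩ := h1
    simp [hij, hij.symm, normalizedMatrix_sdiff_edge p G hij, normalizedMatrix_sup_edge p G hij]
  by_cases h2 : j = a ∧ i = b
  · obtain ⟨rfl, rfl⟩ := h2
    have h3 (G' : SimpleGraph V) : normalizedMatrix p G' j i = normalizedMatrix p G' i j :=
      (normalizedMatrix_isHermitian p G').apply i j
    simp [hij, hij.symm, h3, normalizedMatrix_sdiff_edge p G hij,
      normalizedMatrix_sup_edge p G hij]
  · have h3 : ¬(SimpleGraph.edge i j).Adj a b := by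
      rw [SimpleGraph.edge_adj]
      grind
    have h4 : (G \ SimpleGraph.edge i j).Adj a b ↔ G.Adj a b := by
      rw [SimpleGraph.sdiff_adj]; tauto
    have h5 : (G ⊔ SimpleGraph.edge i j).Adj a b ↔ G.Adj a b := by
      rw [SimpleGraph.sup_adj]; tauto
    by_cases h : G.Adj a b
    · simp only [normalizedMatrix, of_apply, h1, h2, h4.2 h, h5.2 h, if_false]
      ring
    · simp only [normalizedMatrix, of_apply, h1, h2, mt h4.1 h, mt h5.1 h, if_false]
      ring

/-- The entry is centered given all other edges: `(1-p)(-p) + p(1-p) = 0`. -/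
theorem graphMean_normalizedMatrix_mul {p : unitInterval} {i j : V} (hij : i ≠ j)
    {F : SimpleGraph V → ℂ}
    (hF : ∀ G, F (G \ SimpleGraph.edge i j) = F (G ⊔ SimpleGraph.edge i j)) :
    graphMean p (fun G => (normalizedMatrix p G i j : ℂ) * F G) = 0 := by
  rw [graphMean_resample _ hij]
  rw [← graphMean_const (p := p) (V := V) (0 : ℂ)]
  congr 1
  ext1 G
  rw [normalizedMatrix_sdiff_edge _ G hij, normalizedMatrix_sup_edge _ G hij, hF]
  simp only [Complex.real_smul]
  push_cast
  ring

/-- The conditional variance comes from `(1-p)p² + p(1-p)² = p(1-p)`. -/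
theorem graphMean_normalizedMatrix_sq_mul {p : unitInterval} {i j : V} (hij : i ≠ j)
    {F : SimpleGraph V → ℂ}
    (hF : ∀ G, F (G \ SimpleGraph.edge i j) = F (G ⊔ SimpleGraph.edge i j)) :
    graphMean p (fun G => (normalizedMatrix p G i j : ℂ) ^ 2 * F G) =
      ((p * (1 - p) / Fintype.card V : ℝ) : ℂ) * graphMean p F := by
  rw [graphMean_resample _ hij, graphMean_resample F hij, ← graphMean_const_mul]
  congr 1
  ext1 G
  have hs : ((√(Fintype.card V) : ℝ) : ℂ) ^ 2 = (Fintype.card V : ℂ) := by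
    rw [← Complex.ofReal_pow, Real.sq_sqrt (Nat.cast_nonneg _), Complex.ofReal_natCast]
  rw [normalizedMatrix_sdiff_edge _ G hij, normalizedMatrix_sup_edge _ G hij, hF]
  simp only [Complex.real_smul]
  push_cast
  rw [div_pow, div_pow, hs]
  ring

end CenteredMatrix

/-! ### The approximate quadratic equation for the normalized trace. -/

section SelfConsistency

variable {V : Type*} [Fintype V] [DecidableEq V]

/-- The normalized trace of the resolvent at `it`. -/
noncomputable def stieltjes (H : Matrix V V ℝ) (t : ℝ) : ℂ :=
  (Fintype.card V : ℂ)⁻¹ * ∑ k, imResolvent H t k k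

/-- The defect of the normalized trace in the quadratic equation `1 + zs + qs² = 0` at `z = it`. -/
noncomputable def quadraticDefect (q : ℝ) (H : Matrix V V ℝ) (t : ℝ) : ℂ :=
  1 + t * Complex.I * stieltjes H t + q * stieltjes H t ^ 2

theorem norm_stieltjes_le {H : Matrix V V ℝ} (hH : H.IsHermitian) {t : ℝ} (ht : 0 < t) :
    ‖stieltjes H t‖ ≤ 1 / t := by
  rw [stieltjes, norm_mul, norm_inv, Complex.norm_natCast]
  have h1 : ‖∑ k, imResolvent H t k k‖ ≤ Fintype.card V * (1 / t) := by
    refine (norm_sum_le _ _).trans ((Finset.sum_le_sum fun k _ =>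
      norm_imResolvent_le hH ht k k).trans_eq ?_)
    simp
  rcases Nat.eq_zero_or_pos (Fintype.card V) with h | h
  · rw [h]; simp; positivity
  · rw [inv_mul_le_iff₀ (by exact_mod_cast h)]
    exact h1

theorem norm_quadraticDefect_le {q : ℝ} (hq0 : 0 ≤ q) (hq1 : q ≤ 1) {H : Matrix V V ℝ}
    (hH : H.IsHermitian) {t : ℝ} (ht : 0 < t) :
    ‖quadraticDefect q H t‖ ≤ 2 + (1 / t) ^ 2 := by
  have h := norm_stieltjes_le hH ht
  have h2 : t * ‖stieltjes H t‖ ≤ 1 := by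
    rw [le_div_iff₀ ht] at h; linarith
  have h3 : ‖stieltjes H t‖ ^ 2 ≤ (1 / t) ^ 2 := pow_le_pow_left₀ (norm_nonneg _) h 2
  have h4 : q * ‖stieltjes H t‖ ^ 2 ≤ (1 / t) ^ 2 :=
    (mul_le_of_le_one_left (sq_nonneg _) hq1).trans h3
  refine (norm_add₃_le).trans ?_
  simp only [norm_mul, norm_pow, Complex.norm_I, mul_one, norm_one, Complex.norm_real,
    Real.norm_of_nonneg ht.le, Real.norm_of_nonneg hq0]
  linarith

/-- By the resolvent identity the change of the trace is a sum of two products of a column of one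
resolvent with a column of the other. Columns have norm at most `1/t`, so the trace moves by
`O(|h|)` with no factor of the dimension. -/
theorem norm_stieltjes_sub_le {H H' : Matrix V V ℝ} (hH : H.IsHermitian) (hH' : H'.IsHermitian)
    {t : ℝ} (ht : 0 < t) {i j : V} {h : ℝ}
    (hd : H - H' = h • (single i j 1 + single j i 1)) :
    ‖stieltjes H t - stieltjes H' t‖ ≤ (Fintype.card V : ℝ)⁻¹ * (2 * |h| * (1 / t) ^ 2) := by
  have hcs (a b : V) : ‖∑ k, imResolvent H' t k a * imResolvent H t b k‖ ≤ (1 / t) ^ 2 := by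
    have h1 := sum_norm_sq_imResolvent_le hH' ht a
    have h2 := sum_norm_sq_imResolvent_le hH ht b
    refine (norm_sum_le _ _).trans ?_
    calc ∑ k, ‖imResolvent H' t k a * imResolvent H t b k‖
        ≤ ∑ k, (‖imResolvent H' t k a‖ ^ 2 + ‖imResolvent H t k b‖ ^ 2) / 2 := by
          refine Finset.sum_le_sum fun k _ => ?_
          rw [norm_mul, imResolvent_comm hH t b k]
          nlinarith [sq_nonneg (‖imResolvent H' t k a‖ - ‖imResolvent H t k b‖)]
      _ ≤ _ := by
          rw [← Finset.sum_div, Finset.sum_add_distrib]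
          linarith
  rw [stieltjes, stieltjes, ← mul_sub, ← Finset.sum_sub_distrib, norm_mul, norm_inv,
    Complex.norm_natCast]
  gcongr
  simp only [imResolvent_sub_apply hH hH' ht hd, Finset.sum_neg_distrib, ← Finset.mul_sum,
    Finset.sum_add_distrib, norm_neg, norm_mul, Complex.norm_real, Real.norm_eq_abs]
  have h3 := (norm_add_le (∑ k, imResolvent H' t k i * imResolvent H t j k)
    (∑ k, imResolvent H' t k j * imResolvent H t i k)).trans (add_le_add (hcs i j) (hcs j i))
  nlinarith [mul_le_mul_of_nonneg_left h3 (abs_nonneg h)]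

theorem norm_quadraticDefect_sub_le {q : ℝ} (hq0 : 0 ≤ q) (hq1 : q ≤ 1) {H H' : Matrix V V ℝ}
    (hH : H.IsHermitian) (hH' : H'.IsHermitian)
    {t : ℝ} (ht : 0 < t) {i j : V} {h : ℝ}
    (hd : H - H' = h • (single i j 1 + single j i 1)) :
    ‖quadraticDefect q H t - quadraticDefect q H' t‖ ≤
      (Fintype.card V : ℝ)⁻¹ * (2 * |h| * (1 / t) ^ 2) * (t + 2 * (1 / t)) := by
  have h1 := norm_stieltjes_le hH ht
  have h2 := norm_stieltjes_le hH' ht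
  have h3 := norm_stieltjes_sub_le hH hH' ht hd
  have h4 : quadraticDefect q H t - quadraticDefect q H' t = (stieltjes H t - stieltjes H' t) *
      (t * Complex.I + q * (stieltjes H t + stieltjes H' t)) := by
    rw [quadraticDefect, quadraticDefect]; ring
  rw [h4, norm_mul]
  refine mul_le_mul h3 ?_ (norm_nonneg _) (by positivity)
  refine (norm_add_le _ _).trans ?_
  simp only [norm_mul, Complex.norm_I, mul_one, Complex.norm_real, Real.norm_of_nonneg ht.le,
    Real.norm_of_nonneg hq0]
  have h5 := (norm_add_le (stieltjes H t) (stieltjes H' t)).trans (add_le_add h1 h2)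
  have h6 := mul_le_of_le_one_left (norm_nonneg (stieltjes H t + stieltjes H' t)) hq1
  linarith

/-- The diagonal entries of `(H - it) R = 1` give `∑ j, H_ij R_ji = 1 + it R_ii`; averaging over `i`
produces `1 + its`, while `qs²` is the double sum of `R_ii R_jj`. -/
theorem quadraticDefect_eq_sum [Nonempty V] (q : ℝ) {H : Matrix V V ℝ} (hH : H.IsHermitian)
    {t : ℝ} (ht : 0 < t) :
    quadraticDefect q H t = (Fintype.card V : ℂ)⁻¹ * ∑ i, ∑ j, ((H i j : ℂ) * imResolvent H t j i +
      ((q / Fintype.card V : ℝ) : ℂ) * (imResolvent H t i i * imResolvent H t j j)) := by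
  have hn : (Fintype.card V : ℂ) ≠ 0 := by exact_mod_cast Fintype.card_ne_zero
  have h1 (i : V) : ∑ j, (H i j : ℂ) * imResolvent H t j i =
      1 + t * Complex.I * imResolvent H t i i := by
    have := congrFun (congrFun (imShift_mul_imResolvent hH ht) i) i
    rw [imShift, Matrix.sub_mul, Matrix.smul_mul, Matrix.one_mul, Matrix.sub_apply,
      Matrix.smul_apply, Matrix.mul_apply, one_apply_eq, smul_eq_mul] at this
    simp only [Matrix.map_apply, Complex.ofRealHom_eq_coe] at this
    linear_combination this
  simp only [Finset.sum_add_distrib, h1, ← Finset.mul_sum, ← Finset.sum_mul]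
  rw [quadraticDefect, stieltjes]
  simp only [Finset.sum_const, Finset.card_univ, nsmul_eq_mul, mul_one]
  push_cast
  field_simp

end SelfConsistency
-- Second moment of the defect by resampling single edges.
section DefectBound

variable {V : Type*} [Fintype V] [DecidableEq V]

theorem norm_mul_add_mul_le {u v x y : ℂ} {A B C D : ℝ} (hu : ‖u‖ ≤ A) (hv : ‖v‖ ≤ B)
    (hx : ‖x‖ ≤ C) (hy : ‖y‖ ≤ D) : ‖u * v + x * y‖ ≤ A * B + C * D := by
  have hA := (norm_nonneg _).trans hu
  have hC := (norm_nonneg _).trans hx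
  refine (norm_add_le _ _).trans ?_
  rw [norm_mul, norm_mul]
  gcongr

/-- The bound on the error made by the first-order expansion in one entry. -/
noncomputable def expansionError (t : ℝ) : ℝ :=
  2 * (1 / t) ^ 2 * (t + 2 * (1 / t)) * (1 / t + 2 * (1 / t) ^ 2) +
    12 * (2 + (1 / t) ^ 2) * (1 / t) ^ 3

theorem expansionError_nonneg {t : ℝ} (ht : 0 < t) : 0 ≤ expansionError t := by
  unfold expansionError; positivity

/-- Write `h` for the entry `ij` and expand `h R_ji Q` about the erased matrix, which is independent
of `h`. The term linear in `h` has mean zero. The quadratic term is `-h² (R_ji² + R_ii R_jj) Q` with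
erased resolvents, and its mean cancels the added `q/n` term up to the cost of restoring the entry.
What remains is of order `n^{-3/2}`, since `|h| ≤ n^{-1/2}`. -/
theorem norm_graphMean_entry_le [Nonempty V] (p : unitInterval) {q : ℝ} (hq : q = p * (1 - p))
    {i j : V} (hij : i ≠ j) {t : ℝ} (ht : 0 < t) :
    ‖graphMean p (fun G : SimpleGraph V =>
      ((normalizedMatrix p G i j : ℂ) * imResolvent (normalizedMatrix p G) t j i +
      ((q / Fintype.card V : ℝ) : ℂ) * (imResolvent (normalizedMatrix p G) t j i ^ 2 +
        imResolvent (normalizedMatrix p G) t i i * imResolvent (normalizedMatrix p G) t j j)) *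
        (starRingEnd ℂ) (quadraticDefect q (normalizedMatrix p G) t))‖ ≤
      expansionError t * (1 / √(Fintype.card V)) ^ 3 := by
  have hp0 := p.2.1
  have hp1 := p.2.2
  have hq0 : 0 ≤ q := by rw [hq]; exact mul_nonneg hp0 (by linarith)
  have hq1 : q ≤ 1 := by rw [hq]; nlinarith
  set n : ℝ := (Fintype.card V : ℝ) with hn
  have hn1 : 1 ≤ n := by rw [hn]; exact_mod_cast Fintype.card_pos
  set η : ℝ := 1 / √n with hη
  have hη0 : 0 ≤ η := by positivity
  have hη1 : η ≤ 1 := by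
    rw [hη, div_le_one (by positivity)]; exact Real.one_le_sqrt.2 hn1
  have hη2 : n⁻¹ = η ^ 2 := by rw [hη, div_pow, Real.sq_sqrt (by linarith), one_pow, one_div]
  set K : ℝ := 1 / t with hK
  have hK0 : 0 ≤ K := by positivity
  set B : ℝ := 2 + K ^ 2 with hB
  set D : ℝ := 2 * K ^ 2 * (t + 2 * K) with hD
  have hB0 : 0 ≤ B := by positivity
  have hD0 : 0 ≤ D := by positivity
  let h : SimpleGraph V → ℝ := fun G => normalizedMatrix p G i j
  let R : SimpleGraph V → Matrix V V ℂ := fun G => imResolvent (normalizedMatrix p G) t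
  let R0 : SimpleGraph V → Matrix V V ℂ := fun G => imResolvent (erasedMatrix p i j G) t
  let Q : SimpleGraph V → ℂ := fun G =>
    (starRingEnd ℂ) (quadraticDefect q (normalizedMatrix p G) t)
  let Q0 : SimpleGraph V → ℂ := fun G =>
    (starRingEnd ℂ) (quadraticDefect q (erasedMatrix p i j G) t)
  have hd (G : SimpleGraph V) : normalizedMatrix p G - erasedMatrix p i j G =
      h G • (single i j 1 + single j i 1) := by simp [erasedMatrix, h]
  have hH (G : SimpleGraph V) := normalizedMatrix_isHermitian p G
  have hH0 (G : SimpleGraph V) := erasedMatrix_isHermitian p i j G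
  have hh (G) : |h G| ≤ η := abs_normalizedMatrix_le p G i j
  have hR (G a b) : ‖R G a b‖ ≤ K := norm_imResolvent_le (hH G) ht a b
  have hR0 (G a b) : ‖R0 G a b‖ ≤ K := norm_imResolvent_le (hH0 G) ht a b
  have hQ (G) : ‖Q G‖ ≤ B := by
    rw [show ‖Q G‖ = _ from RCLike.norm_conj _]
    exact norm_quadraticDefect_le hq0 hq1 (hH G) ht
  have hQ0 (G) : ‖Q0 G‖ ≤ B := by
    rw [show ‖Q0 G‖ = _ from RCLike.norm_conj _]
    exact norm_quadraticDefect_le hq0 hq1 (hH0 G) ht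
  have hexp (G a b) : R G a b - R0 G a b =
      -(h G * (R0 G a i * R G j b + R0 G a j * R G i b)) :=
    imResolvent_sub_apply (hH G) (hH0 G) ht (hd G) a b
  have hRd (G a b) : ‖R G a b - R0 G a b‖ ≤ 2 * K ^ 2 * η := by
    rw [hexp, norm_neg, norm_mul, Complex.norm_real, Real.norm_eq_abs]
    have := norm_mul_add_mul_le (hR0 G a i) (hR G j b) (hR0 G a j) (hR G i b)
    calc |h G| * ‖R0 G a i * R G j b + R0 G a j * R G i b‖ ≤ η * (K * K + K * K) := by
          gcongr; exact hh G
      _ = _ := by ring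
  -- The defect depends on the matrix only through the normalized trace, so it gains a factor `1/n`
  -- beyond the size of `h`; hence no first-order term for `Q` is needed.
  have hQd (G) : ‖Q G - Q0 G‖ ≤ D * η ^ 3 := by
    have := norm_quadraticDefect_sub_le hq0 hq1 (hH G) (hH0 G) ht (hd G)
    rw [← hn, hη2] at this
    have h1 : ‖Q G - Q0 G‖ ≤ η ^ 2 * (2 * |h G| * K ^ 2) * (t + 2 * K) := by
      simp only [Q, Q0, ← map_sub, RCLike.norm_conj]
      exact this
    refine h1.trans ?_
    calc η ^ 2 * (2 * |h G| * K ^ 2) * (t + 2 * K) ≤ η ^ 2 * (2 * η * K ^ 2) * (t + 2 * K) := by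
          gcongr; exact hh G
      _ = _ := by rw [hD]; ring
  let Z : SimpleGraph V → ℂ := fun G => (R G j i ^ 2 + R G i i * R G j j) * Q G
  let Z0 : SimpleGraph V → ℂ := fun G => (R0 G j i ^ 2 + R0 G i i * R0 G j j) * Q0 G
  have hinv (G) : erasedMatrix p i j (G \ SimpleGraph.edge i j) =
      erasedMatrix p i j (G ⊔ SimpleGraph.edge i j) := erasedMatrix_resample p hij G
  have m1 : graphMean p (fun G => (h G : ℂ) * (R0 G j i * Q0 G)) = 0 :=
    graphMean_normalizedMatrix_mul hij fun G => by simp only [R0, Q0, hinv]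
  have m2 : graphMean p (fun G => (h G : ℂ) ^ 2 * Z0 G) =
      ((q / n : ℝ) : ℂ) * graphMean p Z0 := by
    rw [hq]
    exact graphMean_normalizedMatrix_sq_mul hij fun G => by simp only [Z0, R0, Q0, hinv]
  -- The remainder beyond second order: the change of `Q`, and the error from replacing the one
  -- factor `R` in the exact expansion by `R0`.
  let e1 : SimpleGraph V → ℂ := fun G => h G * (R G j i * (Q G - Q0 G)) -
    (h G : ℂ) ^ 2 * (Q0 G * (R0 G j i * (R G j i - R0 G j i) + R0 G j j * (R G i i - R0 G i i)))
  have he (G) : ((h G : ℂ) * R G j i + ((q / n : ℝ) : ℂ) *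
      (R G j i ^ 2 + R G i i * R G j j)) * Q G =
      (h G : ℂ) * (R0 G j i * Q0 G) - (h G : ℂ) ^ 2 * Z0 G + ((q / n : ℝ) : ℂ) * Z0 G +
        (e1 G + ((q / n : ℝ) : ℂ) * (Z G - Z0 G)) := by
    simp only [e1, Z, Z0]
    linear_combination (h G * Q0 G : ℂ) * hexp G j i
  have hn0 : q / n ≤ η ^ 2 := by
    rw [div_eq_mul_inv, hη2]; exact mul_le_of_le_one_left (sq_nonneg _) hq1
  have hqn : 0 ≤ q / n := by positivity
  have be1 (G) : ‖e1 G‖ ≤ (K * D + 4 * B * K ^ 3) * η ^ 3 := by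
    have a1 : ‖(h G : ℂ) * (R G j i * (Q G - Q0 G))‖ ≤ η * (K * (D * η ^ 3)) := by
      rw [norm_mul, norm_mul, Complex.norm_real, Real.norm_eq_abs]
      gcongr
      · exact hh G
      · exact hR G j i
      · exact hQd G
    have a2 := norm_mul_add_mul_le (hR0 G j i) (hRd G j i) (hR0 G j j) (hRd G i i)
    have a3 : ‖(h G : ℂ) ^ 2 * (Q0 G *
        (R0 G j i * (R G j i - R0 G j i) + R0 G j j * (R G i i - R0 G i i)))‖ ≤
        η ^ 2 * (B * (K * (2 * K ^ 2 * η) + K * (2 * K ^ 2 * η))) := by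
      rw [norm_mul, norm_mul, norm_pow, Complex.norm_real, Real.norm_eq_abs]
      gcongr
      · exact hh G
      · exact hQ0 G
    refine (norm_sub_le _ _).trans ((add_le_add a1 a3).trans ?_)
    have : K * D * η ^ 3 * η ≤ K * D * η ^ 3 * 1 := by gcongr
    nlinarith
  have bZ (G) : ‖Z G - Z0 G‖ ≤ (8 * B * K ^ 3 + 2 * K ^ 2 * D) * η := by
    have a1 : Z G - Z0 G = ((R G j i - R0 G j i) * (R G j i + R0 G j i) +
        ((R G i i - R0 G i i) * R G j j + R0 G i i * (R G j j - R0 G j j))) * Q G +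
        (R0 G j i * R0 G j i + R0 G i i * R0 G j j) * (Q G - Q0 G) := by
      simp only [Z, Z0]; ring
    have a2 := norm_mul_add_mul_le (hRd G i i) (hR G j j) (hR0 G i i) (hRd G j j)
    have a3 : ‖(R G j i - R0 G j i) * (R G j i + R0 G j i)‖ ≤ 2 * K ^ 2 * η * (K + K) := by
      rw [norm_mul]
      gcongr
      · exact hRd G j i
      · exact (norm_add_le _ _).trans (add_le_add (hR G j i) (hR0 G j i))
    have a4 := norm_mul_add_mul_le (hR0 G j i) (hR0 G j i) (hR0 G i i) (hR0 G j j)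
    rw [a1]
    refine (norm_mul_add_mul_le ((norm_add_le _ _).trans (add_le_add a3 a2)) (hQ G) a4
      (hQd G)).trans ?_
    have h3 : η ^ 3 ≤ η := by
      calc η ^ 3 ≤ η ^ 1 := pow_le_pow_of_le_one hη0 hη1 (by norm_num)
        _ = η := pow_one η
    have : 2 * K ^ 2 * D * η ^ 3 ≤ 2 * K ^ 2 * D * η := by gcongr
    nlinarith
  have hmean : graphMean p (fun G => ((h G : ℂ) * R G j i + ((q / n : ℝ) : ℂ) *
      (R G j i ^ 2 + R G i i * R G j j)) * Q G) =
      graphMean p (fun G => e1 G + ((q / n : ℝ) : ℂ) * (Z G - Z0 G)) := by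
    simp only [he]
    rw [graphMean_add, graphMean_add, graphMean_sub, m1, m2, graphMean_const_mul]
    ring
  change ‖graphMean p (fun G => ((h G : ℂ) * R G j i + ((q / n : ℝ) : ℂ) *
      (R G j i ^ 2 + R G i i * R G j j)) * Q G)‖ ≤ _
  rw [hmean]
  refine (norm_graphMean_le _).trans (graphMean_le_of_le fun G => ?_)
  refine (norm_add_le _ _).trans ?_
  rw [norm_mul, Complex.norm_real, Real.norm_of_nonneg hqn]
  calc ‖e1 G‖ + q / n * ‖Z G - Z0 G‖
      ≤ (K * D + 4 * B * K ^ 3) * η ^ 3 + η ^ 2 * ((8 * B * K ^ 3 + 2 * K ^ 2 * D) * η) := by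
        gcongr
        · exact be1 G
        · exact bZ G
    _ = expansionError t * η ^ 3 := by
        rw [expansionError, ← hK, ← hB, hD]; ring

/-- One factor of `|P|² = P · conj P` is written as a sum over entries, and the conjugate plays the
role of `Q` above. The unwanted `(q/n) R_ji²` terms are summed over `j` with the column bound from
the Ward identity, so they contribute only `O(1/n)` in total; the `n²` entry errors of order
`n^{-3/2}`, divided by `n`, give `n^{-1/2}`. -/
theorem graphMean_norm_quadraticDefect_sq_le [Nonempty V] (p : unitInterval) {q : ℝ}
    (hq : q = p * (1 - p)) {t : ℝ} (ht : 0 < t) :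
    graphMean p (fun G : SimpleGraph V => ‖quadraticDefect q (normalizedMatrix p G) t‖ ^ 2) ≤
      ((1 / t) ^ 2 * (2 + (1 / t) ^ 2) + expansionError t) * (1 / √(Fintype.card V)) := by
  have hp0 := p.2.1
  have hp1 := p.2.2
  have hq0 : 0 ≤ q := by rw [hq]; exact mul_nonneg hp0 (by linarith)
  have hq1 : q ≤ 1 := by rw [hq]; nlinarith
  set n : ℝ := (Fintype.card V : ℝ) with hn
  have hn1 : 1 ≤ n := by rw [hn]; exact_mod_cast Fintype.card_pos
  set η : ℝ := 1 / √n with hη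
  have hη0 : 0 ≤ η := by positivity
  have hη1 : η ≤ 1 := by
    rw [hη, div_le_one (by positivity)]; exact Real.one_le_sqrt.2 hn1
  have hη2 : n⁻¹ = η ^ 2 := by rw [hη, div_pow, Real.sq_sqrt (by linarith), one_pow, one_div]
  set K : ℝ := 1 / t with hK
  have hK0 : 0 ≤ K := by positivity
  set B : ℝ := 2 + K ^ 2 with hB
  have hB0 : 0 ≤ B := by positivity
  have hC0 := expansionError_nonneg ht
  have hn0 : q / n ≤ η ^ 2 := by
    rw [div_eq_mul_inv, hη2]; exact mul_le_of_le_one_left (sq_nonneg _) hq1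
  have hqn : 0 ≤ q / n := by positivity
  let R : SimpleGraph V → Matrix V V ℂ := fun G => imResolvent (normalizedMatrix p G) t
  let P : SimpleGraph V → ℂ := fun G => quadraticDefect q (normalizedMatrix p G) t
  let X : V → V → SimpleGraph V → ℂ := fun i j G => (normalizedMatrix p G i j : ℂ) * R G j i +
      ((q / n : ℝ) : ℂ) * (R G i i * R G j j)
  have hH (G : SimpleGraph V) := normalizedMatrix_isHermitian p G
  have hP (G) : ‖P G‖ ≤ B := norm_quadraticDefect_le hq0 hq1 (hH G) ht
  have hsub (i j : V) : ‖graphMean p (fun G => ((q / n : ℝ) : ℂ) *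
      (R G j i ^ 2 * (starRingEnd ℂ) (P G)))‖ ≤
        η ^ 2 * B * graphMean p (fun G => ‖R G j i‖ ^ 2) := by
    rw [← graphMean_const_mul]
    refine (norm_graphMean_le _).trans (graphMean_mono fun G => ?_)
    rw [norm_mul, norm_mul, Complex.norm_real, Real.norm_of_nonneg hqn, norm_pow,
      RCLike.norm_conj]
    calc q / n * (‖R G j i‖ ^ 2 * ‖P G‖) ≤ η ^ 2 * (‖R G j i‖ ^ 2 * B) := by
          gcongr; exact hP G
      _ = _ := by ring
  have hX (i j : V) : ‖graphMean p (fun G => X i j G * (starRingEnd ℂ) (P G))‖ ≤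
      η ^ 2 * B * graphMean p (fun G => ‖R G j i‖ ^ 2) + expansionError t * η ^ 3 := by
    -- On the diagonal the matrix vanishes and `X i i` is exactly the `R_ii²` term, already covered
    -- by `hsub`.
    by_cases hij : i = j
    · subst hij
      refine le_trans (le_of_eq ?_) ((hsub i i).trans (le_add_of_nonneg_right (by positivity)))
      congr 2
      ext1 G
      simp [X, normalizedMatrix]
      ring
    · have h1 := norm_graphMean_entry_le (V := V) p hq hij ht
      have h2 : graphMean p (fun G => X i j G * (starRingEnd ℂ) (P G)) =
          graphMean p (fun G => ((normalizedMatrix p G i j : ℂ) * R G j i +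
            ((q / n : ℝ) : ℂ) * (R G j i ^ 2 + R G i i * R G j j)) * (starRingEnd ℂ) (P G)) -
          graphMean p (fun G => ((q / n : ℝ) : ℂ) *
            (R G j i ^ 2 * (starRingEnd ℂ) (P G))) := by
        rw [← graphMean_sub]
        congr 1
        ext1 G
        simp only [X]
        ring
      rw [h2, add_comm]
      exact (norm_sub_le _ _).trans (add_le_add h1 (hsub i j))
  have hrow (i : V) : ∑ j, ‖graphMean p (fun G => X i j G * (starRingEnd ℂ) (P G))‖ ≤
      η ^ 2 * B * K ^ 2 + n * (expansionError t * η ^ 3) := by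
    refine (Finset.sum_le_sum fun j _ => hX i j).trans ?_
    rw [Finset.sum_add_distrib, ← Finset.mul_sum, ← graphMean_sum, Finset.sum_const,
      Finset.card_univ, nsmul_eq_mul, ← hn]
    gcongr
    exact graphMean_le_of_le fun G => sum_norm_sq_imResolvent_le (hH G) ht i
  have hsq : ((graphMean p (fun G => ‖P G‖ ^ 2) : ℝ) : ℂ) = (Fintype.card V : ℂ)⁻¹ *
      ∑ i, ∑ j, graphMean p (fun G => X i j G * (starRingEnd ℂ) (P G)) := by
    rw [← graphMean_ofReal]
    simp only [← graphMean_sum]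
    rw [← graphMean_const_mul]
    congr 1
    ext1 G
    simp only [← Finset.sum_mul]
    rw [← mul_assoc, ← quadraticDefect_eq_sum q (hH G) ht, Complex.mul_conj']
    push_cast
    rfl
  have hnn : 0 ≤ graphMean p (fun G => ‖P G‖ ^ 2) := graphMean_nonneg fun G => by positivity
  have hfin : graphMean p (fun G => ‖P G‖ ^ 2) ≤
      n⁻¹ * (n * (η ^ 2 * B * K ^ 2 + n * (expansionError t * η ^ 3))) := by
    rw [← Real.norm_of_nonneg hnn, ← Complex.norm_real, hsq, norm_mul, norm_inv,
      Complex.norm_natCast]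
    gcongr
    refine (norm_sum_le _ _).trans ((Finset.sum_le_sum fun i _ =>
      (norm_sum_le _ _).trans (hrow i)).trans_eq ?_)
    simp only [Finset.sum_const, Finset.card_univ, nsmul_eq_mul, ← hn]
  refine hfin.trans ?_
  have hnη : n * η ^ 2 = 1 := by rw [← hη2]; field_simp
  have e : n⁻¹ * (n * (η ^ 2 * B * K ^ 2 + n * (expansionError t * η ^ 3))) =
      B * K ^ 2 * η * η + expansionError t * η := by
    rw [inv_mul_cancel_left₀ (by positivity)]
    linear_combination expansionError t * η * hnη
  rw [e]
  have : B * K ^ 2 * η * η ≤ B * K ^ 2 * η * 1 := by gcongr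
  nlinarith

end DefectBound
-- Coulson's formula and the integral of the limit profile.
section Coulson

open MeasureTheory Set

/-- Coulson's integral formula for the absolute value. -/
theorem integral_Ioi_sq_div_sq_add_sq (x : ℝ) :
    ∫ t in Ioi (0 : ℝ), x ^ 2 / (x ^ 2 + t ^ 2) = Real.pi / 2 * |x| := by
  rcases eq_or_ne x 0 with rfl | hx
  · simp
  have hx0 : 0 < |x| := abs_pos.2 hx
  have h1 (t : ℝ) : x ^ 2 / (x ^ 2 + t ^ 2) = (1 + (|x|⁻¹ * t) ^ 2)⁻¹ := by
    rw [mul_pow, inv_pow, sq_abs]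
    field_simp
  simp only [h1]
  rw [integral_comp_mul_left_Ioi (fun y => (1 + y ^ 2)⁻¹) 0 (inv_pos.2 hx0), mul_zero,
    integral_Ioi_inv_one_add_sq]
  simp [mul_comm]

/-- The limit of the normalized sum of `x² / (x² + t²)` over the eigenvalues `x`. -/
noncomputable def limitProfile (q t : ℝ) : ℝ :=
  1 - t * ((√(t ^ 2 + 4 * q) - t) / (2 * q))

/-- This is the positive root `m` of `qm² + tm = 1`; the number `s = im` solves the limiting
equation `1 + zs + qs² = 0` at `z = it`. -/
theorem positive_root_spec {q : ℝ} (hq : 0 < q) {t : ℝ} (ht : 0 < t) :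
    0 ≤ (√(t ^ 2 + 4 * q) - t) / (2 * q) ∧
    1 - t * ((√(t ^ 2 + 4 * q) - t) / (2 * q)) = q * ((√(t ^ 2 + 4 * q) - t) / (2 * q)) ^ 2 := by
  have hs : √(t ^ 2 + 4 * q) ^ 2 = t ^ 2 + 4 * q := Real.sq_sqrt (by positivity)
  have h1 : t ≤ √(t ^ 2 + 4 * q) := Real.le_sqrt_of_sq_le (by linarith)
  refine ⟨div_nonneg (by linarith) (by linarith), ?_⟩
  field_simp
  linear_combination -hs

theorem limitProfile_nonneg {q : ℝ} (hq : 0 < q) {t : ℝ} (ht : 0 < t) : 0 ≤ limitProfile q t := by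
  rw [limitProfile, (positive_root_spec hq ht).2]
  positivity

theorem limitProfile_le {q : ℝ} (hq : 0 < q) (hq1 : q ≤ 1) {t : ℝ} (ht : 0 < t) :
    limitProfile q t ≤ 2 * (1 + t ^ 2)⁻¹ := by
  obtain ⟨h0, h1⟩ := positive_root_spec hq ht
  rw [limitProfile]
  set m := (√(t ^ 2 + 4 * q) - t) / (2 * q)
  have h2 : 0 ≤ t * m := by positivity
  have h3 : t * m ≤ 1 := by nlinarith [mul_nonneg hq.le (sq_nonneg m)]
  rw [← div_eq_mul_inv, le_div_iff₀ (by positivity)]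
  have h4 : t ^ 2 * (q * m ^ 2) ≤ 1 := by
    calc t ^ 2 * (q * m ^ 2) = q * (t * m) ^ 2 := by ring
      _ ≤ 1 * 1 ^ 2 := by gcongr
      _ = 1 := by norm_num
  rw [← h1] at h4
  nlinarith

/-- An explicit antiderivative `F` vanishes at infinity and equals `-(4/3)√q` at 0. -/
theorem integral_Ioi_limitProfile {q : ℝ} (hq : 0 < q) :
    ∫ t in Ioi (0 : ℝ), limitProfile q t = 4 / 3 * √q := by
  have hpos (t : ℝ) : 0 < t ^ 2 + 4 * q := by positivity
  let F : ℝ → ℝ := fun t => t + t ^ 3 / (6 * q) - √(t ^ 2 + 4 * q) ^ 3 / (6 * q)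
  have hderiv (t : ℝ) : HasDerivAt F (limitProfile q t) t := by
    have h1 : HasDerivAt (fun t : ℝ => t ^ 2 + 4 * q) (2 * t) t := by
      simpa using (hasDerivAt_pow 2 t).add_const (4 * q)
    have h2 := ((h1.sqrt (hpos t).ne').pow 3).div_const (6 * q)
    have h3 := ((hasDerivAt_id t).add ((hasDerivAt_pow 3 t).div_const (6 * q))).sub h2
    refine h3.congr_deriv ?_
    have hs : √(t ^ 2 + 4 * q) ≠ 0 := (Real.sqrt_pos.2 (hpos t)).ne'
    rw [limitProfile]
    field_simp
    ring
  have htend : Tendsto F atTop (𝓝 0) := by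
    have hb : Tendsto (fun t : ℝ => 8 * q / 3 * t⁻¹) atTop (𝓝 0) := by
      simpa using tendsto_inv_atTop_zero.const_mul (8 * q / 3)
    refine squeeze_zero_norm' ?_ hb
    filter_upwards [eventually_gt_atTop 0] with t ht
    set r := √(t ^ 2 + 4 * q) with hr
    have hs : r ^ 2 = t ^ 2 + 4 * q := Real.sq_sqrt (hpos t).le
    have hr0 : 0 < r := Real.sqrt_pos.2 (hpos t)
    have hq4 : q = (r ^ 2 - t ^ 2) / 4 := by linarith
    have hrt : t ≤ r := Real.le_sqrt_of_sq_le (by linarith)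
    have hF : F t * (6 * q) = 6 * q * t + t ^ 3 - r ^ 3 := by
      simp only [F, ← hr]; field_simp
    -- Substituting `4q = r² - t²` removes the cancellation between the cubic terms of `F` and
    -- leaves decay like `1/t`.
    have h1 : F t * (3 * (r + t)) = -((r - t) * (t + 2 * r)) := by
      have : (6 * q) * (F t * (3 * (r + t))) = (6 * q) * -((r - t) * (t + 2 * r)) := by
        calc (6 * q) * (F t * (3 * (r + t))) = F t * (6 * q) * (3 * (r + t)) := by ring
          _ = _ := by rw [hF, hq4]; ring
      exact mul_left_cancel₀ (by positivity) this
    have h2 : |F t| * (3 * (r + t)) = (r - t) * (t + 2 * r) := by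
      rw [← abs_of_pos (show 0 < 3 * (r + t) by positivity), ← abs_mul, h1, abs_neg, abs_of_nonneg]
      exact mul_nonneg (by linarith) (by positivity)
    rw [Real.norm_eq_abs, ← div_eq_mul_inv, le_div_iff₀ ht]
    have h3 : |F t| * (3 * (r + t)) * (r + t) = 4 * q * (t + 2 * r) := by
      rw [h2, hq4]; ring
    have h4 : (|F t| * t * 3) * (r + t) ≤ (8 * q) * (r + t) := by
      have : |F t| * t * 3 * (r + t) ≤ |F t| * (3 * (r + t)) * (r + t) := by
        have := mul_nonneg (abs_nonneg (F t)) (mul_nonneg hr0.le (add_pos hr0 ht).le)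
        nlinarith
      nlinarith
    have := le_of_mul_le_mul_right h4 (by positivity)
    linarith
  rw [integral_Ioi_of_hasDerivAt_of_nonneg' (fun t _ => hderiv t)
    (fun t ht => limitProfile_nonneg hq ht) htend]
  have h4 : √(0 ^ 2 + 4 * q) = 2 * √q := by
    rw [show (0 : ℝ) ^ 2 + 4 * q = 2 ^ 2 * q by ring, Real.sqrt_mul (by norm_num),
      Real.sqrt_sq (by norm_num)]
  have hsq : √q ^ 2 = q := Real.sq_sqrt hq.le
  simp only [F, h4]
  field_simp
  linear_combination 24 * √q * hsq

end Coulson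

/-! ### From the resolvent trace to the eigenvalues. -/

section EigenvalueProfile

variable {V : Type*} [Fintype V] [DecidableEq V]

/-- The normalized sum of `x² / (x² + t²)` over the eigenvalues `x` of `H`. -/
noncomputable def eigenvalueProfile {H : Matrix V V ℝ} (hH : H.IsHermitian) (t : ℝ) : ℝ :=
  (Fintype.card V : ℝ)⁻¹ * ∑ k, hH.eigenvalues k ^ 2 / (hH.eigenvalues k ^ 2 + t ^ 2)

theorem sum_eigenvalues_sq {H : Matrix V V ℝ} (hH : H.IsHermitian) :
    ∑ k, hH.eigenvalues k ^ 2 = ∑ i, ∑ j, H i j ^ 2 := by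
  obtain ⟨U, hU, -, hA⟩ := hH.exists_orthogonal_diagonalization
  have h1 : ∑ i, ∑ j, H i j ^ 2 = (H * H).trace := by
    simp only [Matrix.trace, diag_apply, Matrix.mul_apply]
    refine Finset.sum_congr rfl fun i _ => Finset.sum_congr rfl fun j _ => ?_
    have := hH.apply i j
    simp only [star_trivial] at this
    rw [this, sq]
  have h2 : H * H = U * (diagonal hH.eigenvalues * diagonal hH.eigenvalues) * Uᵀ := by
    calc H * H = U * diagonal hH.eigenvalues * Uᵀ * (U * diagonal hH.eigenvalues * Uᵀ) := by
          rw [← hA]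
      _ = U * diagonal hH.eigenvalues * (Uᵀ * U) * diagonal hH.eigenvalues * Uᵀ := by
          simp only [Matrix.mul_assoc]
      _ = _ := by rw [hU, Matrix.mul_one]; simp only [Matrix.mul_assoc]
  rw [h1, h2, Matrix.trace_mul_comm, ← Matrix.mul_assoc, hU, Matrix.one_mul,
    diagonal_mul_diagonal, trace_diagonal]
  exact Finset.sum_congr rfl fun k _ => sq _

theorem eigenvalueProfile_nonneg {H : Matrix V V ℝ} (hH : H.IsHermitian) (t : ℝ) :
    0 ≤ eigenvalueProfile hH t := by
  unfold eigenvalueProfile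
  exact mul_nonneg (by positivity) (Finset.sum_nonneg fun k _ => by positivity)

/-- This bound, uniform in the dimension, is the dominating function for the integral over `t`. It
rests on `x²(1+t²) ≤ (1+x²)(x²+t²)` and on the mean of `x²` being at most 1. -/
theorem eigenvalueProfile_le [Nonempty V] {H : Matrix V V ℝ} (hH : H.IsHermitian)
    (hF : ∑ i, ∑ j, H i j ^ 2 ≤ Fintype.card V) {t : ℝ} (ht : 0 < t) :
    eigenvalueProfile hH t ≤ 2 * (1 + t ^ 2)⁻¹ := by
  have hn : (0 : ℝ) < Fintype.card V := by exact_mod_cast Fintype.card_pos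
  rw [← sum_eigenvalues_sq hH] at hF
  rw [eigenvalueProfile, inv_mul_le_iff₀ hn, ← div_eq_mul_inv, ← mul_div_assoc,
    le_div_iff₀ (by positivity), Finset.sum_mul]
  calc _ ≤ ∑ k, (1 + hH.eigenvalues k ^ 2) := by
        refine Finset.sum_le_sum fun k _ => ?_
        rw [div_mul_eq_mul_div, div_le_iff₀ (by positivity)]
        nlinarith [sq_nonneg (hH.eigenvalues k), sq_nonneg (hH.eigenvalues k ^ 2), sq_pos_of_pos ht]
    _ ≤ _ := by
        rw [Finset.sum_add_distrib]
        simp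
        linarith

theorem eigenvalueProfile_eq [Nonempty V] {H : Matrix V V ℝ} (hH : H.IsHermitian) {t : ℝ}
    (ht : 0 < t) : eigenvalueProfile hH t = 1 - t * (stieltjes H t).im := by
  have hn : (Fintype.card V : ℝ) ≠ 0 := by exact_mod_cast Fintype.card_ne_zero
  obtain ⟨U, hU, hU', hA⟩ := hH.exists_orthogonal_diagonalization
  have h1 : (stieltjes H t).im = (Fintype.card V : ℝ)⁻¹ *
      ∑ k, t / (hH.eigenvalues k ^ 2 + t ^ 2) := by
    have h2 := trace_imResolvent ht hU hU' hA
    rw [stieltjes, ← Complex.ofReal_natCast, ← Complex.ofReal_inv, Complex.im_ofReal_mul]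
    change _ * ((imResolvent H t).trace).im = _
    rw [h2, Complex.im_sum]
    congr 1
    refine Finset.sum_congr rfl fun k _ => ?_
    rw [Complex.inv_im]
    simp [Complex.normSq_apply, sq]
  have h3 (k : V) : hH.eigenvalues k ^ 2 / (hH.eigenvalues k ^ 2 + t ^ 2) =
      1 - t * (t / (hH.eigenvalues k ^ 2 + t ^ 2)) := by
    field_simp
    ring
  rw [h1, eigenvalueProfile]
  simp only [h3, Finset.sum_sub_distrib, ← Finset.mul_sum]
  simp only [Finset.sum_const, Finset.card_univ, nsmul_eq_mul]
  field_simp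

/-- The quadratic factors as `(s - im)(it + q(s + im))`. Since `Im s ≥ 0` and `m ≥ 0`, the second
factor has modulus at least `t`, which is exactly the factor relating the profile to `Im s`. -/
theorem abs_eigenvalueProfile_sub_le [Nonempty V] {H : Matrix V V ℝ} (hH : H.IsHermitian) {q : ℝ}
    (hq : 0 < q) {t : ℝ} (ht : 0 < t) :
    |eigenvalueProfile hH t - limitProfile q t| ≤ ‖quadraticDefect q H t‖ := by
  obtain ⟨hm, hm'⟩ := positive_root_spec hq ht
  rw [eigenvalueProfile_eq hH ht, limitProfile]
  set m := (√(t ^ 2 + 4 * q) - t) / (2 * q)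
  set s := stieltjes H t with hs
  have hs0 : 0 ≤ s.im := by
    rw [hs, stieltjes, ← Complex.ofReal_natCast, ← Complex.ofReal_inv, Complex.im_ofReal_mul,
      Complex.im_sum]
    refine mul_nonneg (by positivity) (Finset.sum_nonneg fun k _ => ?_)
    rw [imResolvent_im_diag hH ht]
    positivity
  have hmc : (1 : ℂ) - t * m = q * m ^ 2 := by exact_mod_cast congrArg (fun x : ℝ => (x : ℂ)) hm'
  have h1 : quadraticDefect q H t =
      (s - m * Complex.I) * (t * Complex.I + q * (s + m * Complex.I)) := by
    rw [quadraticDefect, ← hs]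
    linear_combination hmc + (t * m + q * m ^ 2) * Complex.I_sq
  have h2 : t ≤ ‖t * Complex.I + q * (s + m * Complex.I)‖ := by
    refine le_trans ?_ ((le_abs_self _).trans (Complex.abs_im_le_norm _))
    simp
    positivity
  have h3 : |s.im - m| ≤ ‖s - m * Complex.I‖ := by
    refine le_trans (le_of_eq ?_) (Complex.abs_im_le_norm _)
    simp
  rw [h1, norm_mul]
  calc |1 - t * s.im - (1 - t * m)| = |s.im - m| * t := by
        rw [show 1 - t * s.im - (1 - t * m) = -((s.im - m) * t) by ring, abs_neg, abs_mul,
          abs_of_pos ht]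
    _ ≤ _ := mul_le_mul h3 h2 ht.le (norm_nonneg _)

open MeasureTheory Set in
theorem integral_eigenvalueProfile {H : Matrix V V ℝ} (hH : H.IsHermitian) :
    ∫ t in Ioi (0 : ℝ), eigenvalueProfile hH t =
      Real.pi / 2 * ((Fintype.card V : ℝ)⁻¹ * matrixEnergy H hH) := by
  unfold eigenvalueProfile
  rw [integral_const_mul, integral_finsetSum]
  · simp only [integral_Ioi_sq_div_sq_add_sq, ← Finset.mul_sum, matrixEnergy]
    ring
  · intro k _
    rcases eq_or_ne (hH.eigenvalues k) 0 with h | h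
    · simp [h]
    -- A non-integrable function has Bochner integral 0 by convention, whereas Coulson's value is
    -- positive for a nonzero eigenvalue.
    by_contra hni
    have h1 := integral_Ioi_sq_div_sq_add_sq (hH.eigenvalues k)
    rw [integral_undef hni] at h1
    have := abs_pos.2 h
    have := Real.pi_pos
    nlinarith [mul_pos this (abs_pos.2 h)]

end EigenvalueProfile
-- Convergence in mean of the normalized energy.
section MeanEnergy

open MeasureTheory Set

variable {V : Type*} [Fintype V] [DecidableEq V]

theorem sum_normalizedMatrix_sq_le [Nonempty V] (p : unitInterval) (G : SimpleGraph V) :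
    ∑ i, ∑ j, normalizedMatrix p G i j ^ 2 ≤ Fintype.card V := by
  have hn : (0 : ℝ) < Fintype.card V := by exact_mod_cast Fintype.card_pos
  have h (i j : V) : normalizedMatrix p G i j ^ 2 ≤ (Fintype.card V : ℝ)⁻¹ := by
    rw [← sq_abs]
    refine (pow_le_pow_left₀ (abs_nonneg _) (abs_normalizedMatrix_le p G i j) 2).trans_eq ?_
    rw [div_pow, Real.sq_sqrt hn.le, one_pow, one_div]
  refine (Finset.sum_le_sum fun i _ => Finset.sum_le_sum fun j _ => h i j).trans_eq ?_
  simp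

theorem measurable_eigenvalueProfile {H : Matrix V V ℝ} (hH : H.IsHermitian) :
    Measurable (eigenvalueProfile hH) := by
  unfold eigenvalueProfile
  fun_prop

theorem measurable_limitProfile (q : ℝ) : Measurable (limitProfile q) := by
  unfold limitProfile
  fun_prop

theorem integrableOn_two_mul_inv_one_add_sq :
    IntegrableOn (fun t : ℝ => 2 * (1 + t ^ 2)⁻¹) (Ioi 0) :=
  (integrable_inv_one_add_sq.const_mul 2).integrableOn

theorem integrableOn_of_nonneg_of_le {f : ℝ → ℝ} (hf : Measurable f) (h0 : ∀ t > 0, 0 ≤ f t)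
    (h1 : ∀ t > 0, f t ≤ 2 * (1 + t ^ 2)⁻¹) : IntegrableOn f (Ioi 0) := by
  refine integrableOn_two_mul_inv_one_add_sq.mono' hf.aestronglyMeasurable ?_
  filter_upwards [ae_restrict_mem measurableSet_Ioi] with t ht
  rw [Real.norm_of_nonneg (h0 t ht)]
  exact h1 t ht

/-- The mean distance between the eigenvalue profile and its limit. -/
noncomputable def meanProfileDist (V : Type*) [Fintype V] [DecidableEq V] (p : unitInterval)
    (q t : ℝ) : ℝ :=
  graphMean p fun G : SimpleGraph V =>
    |eigenvalueProfile (normalizedMatrix_isHermitian p G) t - limitProfile q t|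

theorem measurable_meanProfileDist (p : unitInterval) (q : ℝ) :
    Measurable (meanProfileDist V p q) := by
  unfold meanProfileDist graphMean
  simp only [smul_eq_mul]
  refine Finset.measurable_sum _ fun G _ => ?_
  exact (((measurable_eigenvalueProfile (normalizedMatrix_isHermitian p G)).sub
    (measurable_limitProfile q)).abs).const_mul _

theorem abs_profile_sub_le [Nonempty V] (p : unitInterval) (G : SimpleGraph V) {q : ℝ}
    (hq : 0 < q) (hq1 : q ≤ 1) {t : ℝ} (ht : 0 < t) :
    |eigenvalueProfile (normalizedMatrix_isHermitian p G) t - limitProfile q t| ≤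
      2 * (1 + t ^ 2)⁻¹ := by
  have h1 := eigenvalueProfile_nonneg (normalizedMatrix_isHermitian p G) t
  have h2 := eigenvalueProfile_le (normalizedMatrix_isHermitian p G)
    (sum_normalizedMatrix_sq_le p G) ht
  have h3 := limitProfile_nonneg hq ht
  have h4 := limitProfile_le hq hq1 ht
  rw [abs_le]
  constructor <;> linarith

theorem graphMean_abs_energy_sub_le [Nonempty V] (p : unitInterval) {q : ℝ}
    (hq : 0 < q) (hq1 : q ≤ 1) :
    graphMean p (fun G : SimpleGraph V => |(Fintype.card V : ℝ)⁻¹ *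
      matrixEnergy (normalizedMatrix p G) (normalizedMatrix_isHermitian p G) -
        8 / (3 * Real.pi) * √q|) ≤
      2 / Real.pi * ∫ t in Ioi (0 : ℝ), meanProfileDist V p q t := by
  have hpi := Real.pi_pos
  have hint (G : SimpleGraph V) : IntegrableOn (fun t =>
      |eigenvalueProfile (normalizedMatrix_isHermitian p G) t - limitProfile q t|) (Ioi 0) :=
    integrableOn_of_nonneg_of_le
      ((measurable_eigenvalueProfile _).sub (measurable_limitProfile q)).abs
      (fun _ _ => abs_nonneg _) (fun t ht => abs_profile_sub_le p G hq hq1 ht)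
  have h1 : ∫ t in Ioi (0 : ℝ), meanProfileDist V p q t = graphMean p fun G : SimpleGraph V =>
      ∫ t in Ioi (0 : ℝ),
        |eigenvalueProfile (normalizedMatrix_isHermitian p G) t - limitProfile q t| := by
    unfold meanProfileDist graphMean
    simp only [smul_eq_mul]
    rw [integral_finsetSum _ fun G _ => (hint G).const_mul _]
    simp only [integral_const_mul]
  rw [h1, ← graphMean_const_mul]
  refine graphMean_mono fun G => ?_
  have h2 := integral_eigenvalueProfile (normalizedMatrix_isHermitian p G)
  have h3 := integral_Ioi_limitProfile hq
  have i1 : IntegrableOn (eigenvalueProfile (normalizedMatrix_isHermitian p G)) (Ioi 0) :=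
    integrableOn_of_nonneg_of_le (measurable_eigenvalueProfile _)
      (fun t _ => eigenvalueProfile_nonneg _ t)
      (fun t ht => eigenvalueProfile_le _ (sum_normalizedMatrix_sq_le p G) ht)
  have i2 : IntegrableOn (limitProfile q) (Ioi 0) :=
    integrableOn_of_nonneg_of_le (measurable_limitProfile q)
      (fun t ht => limitProfile_nonneg hq ht) (fun t ht => limitProfile_le hq hq1 ht)
  have h4 : (Fintype.card V : ℝ)⁻¹ *
      matrixEnergy (normalizedMatrix p G) (normalizedMatrix_isHermitian p G) -
        8 / (3 * Real.pi) * √q = 2 / Real.pi * ∫ t in Ioi (0 : ℝ),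
          (eigenvalueProfile (normalizedMatrix_isHermitian p G) t - limitProfile q t) := by
    rw [integral_sub i1 i2, h2, h3]
    field_simp
    ring
  rw [h4, abs_mul, abs_of_pos (by positivity)]
  gcongr
  exact abs_integral_le_integral_abs

theorem meanProfileDist_le [Nonempty V] (p : unitInterval) {q : ℝ} (hq : q = p * (1 - p))
    (hq0 : 0 < q) {t : ℝ} (ht : 0 < t) :
    meanProfileDist V p q t ≤
      √(((1 / t) ^ 2 * (2 + (1 / t) ^ 2) + expansionError t) * (1 / √(Fintype.card V))) := by
  apply Real.le_sqrt_of_sq_le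
  refine le_trans ?_ (graphMean_norm_quadraticDefect_sq_le (V := V) p hq ht)
  refine le_trans (pow_le_pow_left₀ (graphMean_nonneg fun G => abs_nonneg _)
    (graphMean_mono fun G => abs_eigenvalueProfile_sub_le _ hq0 ht) 2) (graphMean_sq_le _)

theorem tendsto_graphMean_abs_energy_sub (p : unitInterval) (hp₀ : 0 < p) (hp₁ : p < 1) :
    Tendsto (fun n : ℕ => graphMean p (fun G : SimpleGraph (Fin n) => |(n : ℝ)⁻¹ *
      matrixEnergy (normalizedMatrix p G) (normalizedMatrix_isHermitian p G) -
        8 / (3 * Real.pi) * √((p : ℝ) * (1 - p))|)) atTop (𝓝 0) := by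
  have hp0 : (0 : ℝ) < p := hp₀
  have hp1 : (p : ℝ) < 1 := hp₁
  obtain ⟨q, hq⟩ : ∃ q : ℝ, q = p * (1 - p) := ⟨_, rfl⟩
  have hq0 : 0 < q := by rw [hq]; exact mul_pos hp0 (by linarith)
  have hq1 : q ≤ 1 := by rw [hq]; nlinarith
  rw [← hq]
  have hlim : Tendsto (fun n : ℕ => ∫ t in Ioi (0 : ℝ), meanProfileDist (Fin n) p q t) atTop
      (𝓝 (∫ _ in Ioi (0 : ℝ), (0 : ℝ))) := by
    -- The quantitative bound `meanProfileDist_le` blows up as `t → 0`, so it serves only for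
    -- pointwise convergence; the domination comes from the Frobenius bound.
    refine tendsto_integral_filter_of_dominated_convergence (fun t => 2 * (1 + t ^ 2)⁻¹)
      (Eventually.of_forall fun n => (measurable_meanProfileDist p q).aestronglyMeasurable)
      ?_ integrableOn_two_mul_inv_one_add_sq ?_
    · filter_upwards [eventually_gt_atTop 0] with n hn
      have : Nonempty (Fin n) := ⟨⟨0, hn⟩⟩
      filter_upwards [ae_restrict_mem measurableSet_Ioi] with t ht
      rw [meanProfileDist, Real.norm_of_nonneg (graphMean_nonneg fun G => abs_nonneg _)]
      exact graphMean_le_of_le fun G => abs_profile_sub_le p G hq0 hq1 ht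
    · filter_upwards [ae_restrict_mem measurableSet_Ioi] with t ht
      have hz : Tendsto (fun n : ℕ => √(((1 / t) ^ 2 * (2 + (1 / t) ^ 2) + expansionError t) *
          (1 / √(n : ℝ)))) atTop (𝓝 0) := by
        have h1 : Tendsto (fun n : ℕ => 1 / √(n : ℝ)) atTop (𝓝 0) := by
          simp only [one_div]
          exact (Real.tendsto_sqrt_atTop.comp tendsto_natCast_atTop_atTop).inv_tendsto_atTop
        have h2 := (h1.const_mul ((1 / t) ^ 2 * (2 + (1 / t) ^ 2) + expansionError t)).sqrt
        simpa using h2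
      refine squeeze_zero' (Eventually.of_forall fun n => graphMean_nonneg fun G => abs_nonneg _)
        ?_ hz
      filter_upwards [eventually_gt_atTop 0] with n hn
      have : Nonempty (Fin n) := ⟨⟨0, hn⟩⟩
      simpa using meanProfileDist_le (V := Fin n) p hq hq0 ht
  rw [integral_zero] at hlim
  have hlim2 := hlim.const_mul (2 / Real.pi)
  rw [mul_zero] at hlim2
  refine squeeze_zero' (Eventually.of_forall fun n => graphMean_nonneg fun G => abs_nonneg _)
    ?_ hlim2
  filter_upwards [eventually_gt_atTop 0] with n hn
  have : Nonempty (Fin n) := ⟨⟨0, hn⟩⟩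
  simpa using graphMean_abs_energy_sub_le (V := Fin n) p hq0 hq1

end MeanEnergy
-- Concentration of the degrees in mean square.
section Degrees

variable {V : Type*} [Fintype V] [DecidableEq V]

/-- The sum of the squared deviations of the degrees from `|V| p`. -/
noncomputable def degreeDeviation {V : Type*} [Fintype V] (p : ℝ) (G : SimpleGraph V) : ℝ :=
  open Classical in ∑ v, ((G.degree v : ℝ) - Fintype.card V * p) ^ 2

theorem degreeDeviation_nonneg {V : Type*} [Fintype V] (p : ℝ) (G : SimpleGraph V) :
    0 ≤ degreeDeviation p G :=
  Finset.sum_nonneg fun _ _ => sq_nonneg _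

open Classical in
theorem sqrt_card_mul_normalizedMatrix [Nonempty V] (p : ℝ) (G : SimpleGraph V) (i j : V) :
    √(Fintype.card V) * normalizedMatrix p G i j =
      (if G.Adj i j then 1 else 0) - p + if i = j then p else 0 := by
  have hn : (0 : ℝ) < √(Fintype.card V) :=
    Real.sqrt_pos.2 (by exact_mod_cast Fintype.card_pos)
  by_cases h : i = j
  · subst h
    simp [normalizedMatrix]
  · simp only [normalizedMatrix, of_apply, h, if_false, add_zero]
    field_simp

open Classical in
-- The trailing `-p` arises because deviations are measured from `np` while the mean degree is
-- `(n-1)p`.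
theorem degree_sub_eq [Nonempty V] (p : ℝ) (G : SimpleGraph V) (v : V) :
    (G.degree v : ℝ) - Fintype.card V * p =
      √(Fintype.card V) * (∑ j, normalizedMatrix p G v j) - p := by
  rw [Finset.mul_sum]
  simp only [sqrt_card_mul_normalizedMatrix, Finset.sum_add_distrib, Finset.sum_sub_distrib]
  rw [← SimpleGraph.card_neighborFinset_eq_degree, SimpleGraph.neighborFinset_eq_filter]
  simp

/-- Distinct entries of a row are uncorrelated, so only the `n` diagonal terms survive, each at most
`1/n`. -/
theorem graphMean_row_sum_sq_le [Nonempty V] (p : unitInterval) (v : V) :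
    graphMean p (fun G : SimpleGraph V => (∑ j, normalizedMatrix p G v j) ^ 2) ≤ 1 := by
  have hn : (0 : ℝ) < Fintype.card V := by exact_mod_cast Fintype.card_pos
  have hcross (j k : V) (hjk : j ≠ k) : graphMean p (fun G : SimpleGraph V =>
      normalizedMatrix p G v j * normalizedMatrix p G v k) = 0 := by
    by_cases hv : v = j
    · simp [normalizedMatrix, hv, graphMean]
    have h1 := graphMean_normalizedMatrix_mul (p := p) hv
      (F := fun G => (normalizedMatrix p G v k : ℂ)) fun G => by
        have h := congrFun (congrFun (erasedMatrix_resample (p : ℝ) hv G) v) k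
        simpa [erasedMatrix, single_apply, hjk, Ne.symm hv] using h
    have h2 := graphMean_ofReal (p := p) (fun G : SimpleGraph V =>
      normalizedMatrix p G v j * normalizedMatrix p G v k)
    simp only [Complex.ofReal_mul] at h2
    rw [h1] at h2
    exact_mod_cast h2.symm
  have hdiag (j : V) : graphMean p (fun G : SimpleGraph V =>
      normalizedMatrix p G v j * normalizedMatrix p G v j) ≤ (Fintype.card V : ℝ)⁻¹ := by
    refine graphMean_le_of_le fun G => ?_
    rw [← sq, ← sq_abs]
    refine (pow_le_pow_left₀ (abs_nonneg _) (abs_normalizedMatrix_le p G v j) 2).trans_eq ?_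
    rw [div_pow, Real.sq_sqrt hn.le, one_pow, one_div]
  simp only [sq, Finset.sum_mul_sum, graphMean_sum]
  calc _ ≤ ∑ _j : V, (Fintype.card V : ℝ)⁻¹ := by
        refine Finset.sum_le_sum fun j _ => ?_
        rw [Finset.sum_eq_single j (fun k _ hk => hcross j k hk.symm) (by simp)]
        exact hdiag j
    _ = 1 := by simp

theorem graphMean_degreeDeviation_le [Nonempty V] (p : unitInterval) :
    graphMean p (fun G : SimpleGraph V => degreeDeviation p G) ≤ 4 * (Fintype.card V : ℝ) ^ 2 := by
  have hn : (1 : ℝ) ≤ Fintype.card V := by exact_mod_cast Fintype.card_pos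
  have hp0 := p.2.1
  have hp1 := p.2.2
  simp only [degreeDeviation, graphMean_sum]
  calc _ ≤ ∑ _v : V, 4 * (Fintype.card V : ℝ) := by
        refine Finset.sum_le_sum fun v _ => ?_
        refine (graphMean_mono (g := fun G => 2 * Fintype.card V *
          (∑ j, normalizedMatrix p G v j) ^ 2 + 2) fun G => ?_).trans ?_
        · rw [degree_sub_eq]
          have hs : √(Fintype.card V : ℝ) ^ 2 = Fintype.card V := Real.sq_sqrt (by linarith)
          set Y := ∑ j, normalizedMatrix p G v j
          calc (√(Fintype.card V : ℝ) * Y - p) ^ 2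
              ≤ 2 * (√(Fintype.card V : ℝ) ^ 2 * Y ^ 2) + 2 * (p : ℝ) ^ 2 := by
                nlinarith [sq_nonneg (√(Fintype.card V : ℝ) * Y + p)]
            _ ≤ _ := by rw [hs]; nlinarith
        · rw [graphMean_add, graphMean_const_mul, graphMean_const]
          nlinarith [graphMean_row_sum_sq_le p v]
    _ = _ := by simp; ring

end Degrees

/-! ### Transfer from the centered matrix to degree-weighted matrices. -/

section WeightedEnergy

variable {V : Type*} [Fintype V] [DecidableEq V]

/-- The adjacency matrix is `√n W + p(J - I)`, and the quadratic estimate on `f` bounds the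
Frobenius norm of the rest. The factor `1/2` in `K²/2` absorbs the two equal contributions of the
endpoints `i` and `j`. -/
theorem abs_weightedEnergy_sub_le [Nonempty V] (p : unitInterval) {f : ℝ → ℝ → ℝ}
    (hf : ∀ x y, f x y = f y x) {c K : ℝ} (hc : 0 ≤ c) (hK : 0 ≤ K)
    (hfc : ∀ x y : ℝ, 0 ≤ x → x ≤ Fintype.card V → 0 ≤ y → y ≤ Fintype.card V →
      (f x y - c) ^ 2 ≤ K ^ 2 / 2 *
        ((x - Fintype.card V * p) ^ 2 + (y - Fintype.card V * p) ^ 2))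
    (G : SimpleGraph V) :
    |matrixEnergy (degreeWeightedMatrix f G) (degreeWeightedMatrix_isHermitian hf G) -
      c * √(Fintype.card V) *
        matrixEnergy (normalizedMatrix p G) (normalizedMatrix_isHermitian p G)| ≤
      2 * c * Fintype.card V + Fintype.card V * (K * √(degreeDeviation p G)) := by
  classical
  have hp0 := p.2.1
  have hp1 := p.2.2
  have hn : (0 : ℝ) ≤ Fintype.card V := Nat.cast_nonneg _
  let R : Matrix V V ℝ := of fun i j => if G.Adj i j then f (G.degree i) (G.degree j) - c else 0
  have hdecomp : degreeWeightedMatrix f G = (c * √(Fintype.card V)) • normalizedMatrix p G +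
      ((c * p) • (of fun _ _ => (1 : ℝ)) + (-(c * p)) • (1 : Matrix V V ℝ) + R) := by
    ext i j
    have h := sqrt_card_mul_normalizedMatrix (p : ℝ) G i j
    have h1 : (1 : Matrix V V ℝ) i j = if i = j then 1 else 0 := one_apply
    simp only [Matrix.add_apply, Matrix.smul_apply, smul_eq_mul, of_apply, mul_assoc, h, h1, R,
      degreeWeightedMatrix]
    by_cases hA : G.Adj i j
    · simp only [hA, if_true, hA.ne, if_false]
      convert (show f (G.degree i) (G.degree j) = c * (1 - p + 0) + (c * (p * 1) +
        -(c * (p * 0)) + (f (G.degree i) (G.degree j) - c)) by ring) using 2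
      ring
    · by_cases hij : i = j
      · subst hij
        simp only [hA, if_false, if_true]; ring
      · simp only [hA, if_false, hij]; ring
  have hdeg (v : V) : (G.degree v : ℝ) ≤ Fintype.card V := by
    exact_mod_cast (G.degree_lt_card_verts v).le
  have hR : ∑ i, ∑ j, R i j ^ 2 ≤ Fintype.card V * (K ^ 2 * degreeDeviation p G) := by
    calc ∑ i, ∑ j, R i j ^ 2 ≤ ∑ i, ∑ j, K ^ 2 / 2 *
        (((G.degree i : ℝ) - Fintype.card V * p) ^ 2 +
          ((G.degree j : ℝ) - Fintype.card V * p) ^ 2) := by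
          refine Finset.sum_le_sum fun i _ => Finset.sum_le_sum fun j _ => ?_
          by_cases hA : G.Adj i j
          · simpa [R, hA] using hfc _ _ (Nat.cast_nonneg _) (hdeg i) (Nat.cast_nonneg _) (hdeg j)
          · simp only [R, of_apply, hA, if_false, ne_eq, OfNat.ofNat_ne_zero, not_false_eq_true,
              zero_pow]
            positivity
      _ = _ := by
          simp only [← Finset.mul_sum, Finset.sum_add_distrib, Finset.sum_const, Finset.card_univ,
            nsmul_eq_mul, degreeDeviation]
          ring
  refine (abs_matrixEnergy_sub_le _ (normalizedMatrix_isHermitian (p : ℝ) G) (by positivity)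
    hdecomp).trans ?_
  rw [abs_neg, abs_of_nonneg (mul_nonneg hc hp0)]
  have h1 : √(Fintype.card V * ∑ i, ∑ j, R i j ^ 2) ≤
      Fintype.card V * (K * √(degreeDeviation p G)) := by
    apply Real.sqrt_le_iff.2
    refine ⟨by positivity, ?_⟩
    rw [mul_pow, mul_pow, Real.sq_sqrt (degreeDeviation_nonneg _ _), sq, mul_assoc]
    gcongr
  have h2 : c * p * Fintype.card V ≤ c * Fintype.card V := by
    gcongr; exact mul_le_of_le_one_right hc hp1
  linarith

theorem tendsto_binomialRandom_real_weightedEnergy (p : unitInterval) (hp₀ : 0 < p) (hp₁ : p < 1)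
    {f : ℝ → ℝ → ℝ} (hf : ∀ x y, f x y = f y x) {c K : ℕ → ℝ} {B : ℝ} (hB : 0 ≤ B)
    (hc : ∀ n, 0 < n → 0 < c n) (hK : ∀ n, 0 ≤ K n) (hcK : ∀ n, K n * n = B * c n)
    (hfc : ∀ (n : ℕ) (x y : ℝ), 0 ≤ x → x ≤ n → 0 ≤ y → y ≤ n →
      (f x y - c n) ^ 2 ≤ K n ^ 2 / 2 * ((x - n * p) ^ 2 + (y - n * p) ^ 2))
    {ε : ℝ} (hε : 0 < ε) :
    Tendsto (fun n : ℕ => (SimpleGraph.binomialRandom (Fin n) p).real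
      {G | ¬ |matrixEnergy (degreeWeightedMatrix f G) (degreeWeightedMatrix_isHermitian hf G) -
        8 / (3 * Real.pi) * √((p : ℝ) * (1 - p)) * (c n * (n * √n))| ≤
          ε * (8 / (3 * Real.pi) * √((p : ℝ) * (1 - p)) * (c n * (n * √n)))}) atTop (𝓝 0) := by
  have hp0 : (0 : ℝ) < p := hp₀
  have hp1 : (p : ℝ) < 1 := hp₁
  have hpi := Real.pi_pos
  set τ : ℝ := 8 / (3 * Real.pi) * √((p : ℝ) * (1 - p)) with hτ
  have hτ0 : 0 < τ := by
    have : 0 < √((p : ℝ) * (1 - p)) := Real.sqrt_pos.2 (mul_pos hp0 (by linarith))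
    positivity
  let g : ∀ n : ℕ, SimpleGraph (Fin n) → ℝ := fun n G => |(n : ℝ)⁻¹ *
      matrixEnergy (normalizedMatrix p G) (normalizedMatrix_isHermitian p G) - τ|
  have hg : Tendsto (fun n : ℕ => graphMean p (g n)) atTop (𝓝 0) :=
    tendsto_graphMean_abs_energy_sub p hp₀ hp₁
  -- A bound for the error divided by `c n^{3/2}`: its terms come from `J - I`, the degree
  -- fluctuations and the energy of the centered matrix. The relation `K n = B c` makes the second
  -- scale-free.
  let Ψ : ∀ n : ℕ, SimpleGraph (Fin n) → ℝ := fun n G =>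
    2 / √n + B / (n * √n) * √(degreeDeviation p G) + g n G
  have hΨ0 (n : ℕ) (G) : 0 ≤ Ψ n G := by positivity
  have hpt (n : ℕ) (hn : 0 < n) (G : SimpleGraph (Fin n)) :
      |matrixEnergy (degreeWeightedMatrix f G) (degreeWeightedMatrix_isHermitian hf G) -
        τ * (c n * (n * √n))| ≤ c n * (n * √n) * Ψ n G := by
    have : Nonempty (Fin n) := ⟨⟨0, hn⟩⟩
    have hn' : (0 : ℝ) < n := by exact_mod_cast hn
    have hs : 0 < √(n : ℝ) := Real.sqrt_pos.2 hn'
    have hcn := hc n hn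
    have h1 := abs_weightedEnergy_sub_le p hf (V := Fin n) (c := c n) (K := K n) hcn.le (hK n)
      (by simpa using hfc n) G
    simp only [Fintype.card_fin] at h1
    have hKn : K n = B * c n / n := by rw [← hcK]; field_simp
    have h2 : c n * √n *
        matrixEnergy (normalizedMatrix p G) (normalizedMatrix_isHermitian p G) -
        τ * (c n * (n * √n)) = c n * (n * √n) * ((n : ℝ)⁻¹ *
          matrixEnergy (normalizedMatrix p G) (normalizedMatrix_isHermitian p G) - τ) := by
      field_simp
    have h3 := congrArg abs h2
    rw [abs_mul (c n * (n * √n)), abs_of_pos (show 0 < c n * (n * √n) by positivity)] at h3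
    refine (abs_sub_le _ (c n * √n *
      matrixEnergy (normalizedMatrix p G) (normalizedMatrix_isHermitian p G)) _).trans ?_
    rw [h3]
    refine (add_le_add_left h1 _).trans_eq ?_
    simp only [Ψ, g]
    rw [hKn]
    field_simp
  have hmean (n : ℕ) (hn : 0 < n) : graphMean p (Ψ n) ≤ (2 + 2 * B) * (1 / √n) +
      graphMean p (g n) := by
    have : Nonempty (Fin n) := ⟨⟨0, hn⟩⟩
    have hn' : (0 : ℝ) < n := by exact_mod_cast hn
    have hs : 0 < √(n : ℝ) := Real.sqrt_pos.2 hn'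
    have h1 : graphMean p (fun G : SimpleGraph (Fin n) => √(degreeDeviation p G)) ≤ 2 * n := by
      refine le_of_sq_le_sq ?_ (by positivity)
      refine (graphMean_sq_le _).trans ?_
      simp only [Real.sq_sqrt (degreeDeviation_nonneg _ _)]
      refine (graphMean_degreeDeviation_le p).trans_eq ?_
      rw [Fintype.card_fin]; ring
    simp only [Ψ]
    rw [graphMean_add, graphMean_add, graphMean_const, graphMean_const_mul]
    have h2 : B / (n * √n) * graphMean p
        (fun G : SimpleGraph (Fin n) => √(degreeDeviation p G)) ≤ B / (n * √n) * (2 * n) := by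
      gcongr
    have h3 : B / (n * √n) * (2 * n) = 2 * B * (1 / √n) := by field_simp
    rw [h3] at h2
    have h4 : 2 / √(n : ℝ) = 2 * (1 / √n) := by ring
    rw [h4]
    linarith
  have hlim : Tendsto (fun n : ℕ => ((2 + 2 * B) * (1 / √n) + graphMean p (g n)) / (ε * τ)) atTop
      (𝓝 0) := by
    have h1 : Tendsto (fun n : ℕ => 1 / √(n : ℝ)) atTop (𝓝 0) := by
      simp only [one_div]
      exact (Real.tendsto_sqrt_atTop.comp tendsto_natCast_atTop_atTop).inv_tendsto_atTop
    simpa using ((h1.const_mul (2 + 2 * B)).add hg).div_const (ε * τ)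
  refine squeeze_zero' (Eventually.of_forall fun n => MeasureTheory.measureReal_nonneg) ?_ hlim
  filter_upwards [eventually_gt_atTop 0] with n hn
  have hn' : (0 : ℝ) < n := by exact_mod_cast hn
  have hX : 0 < c n * (n * √n) := mul_pos (hc n hn) (mul_pos hn' (Real.sqrt_pos.2 hn'))
  -- A bad graph forces `Ψ > ετ`, and Markov's inequality bounds the probability of that.
  refine le_trans (MeasureTheory.measureReal_mono (s₂ := {G | ε * τ < Ψ n G}) ?_)
    ((binomialRandom_real_le_graphMean_div (hΨ0 n) (by positivity)).trans ?_)
  · intro G hG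
    have h1 := (not_le.1 hG).trans_le (hpt n hn G)
    change ε * τ < Ψ n G
    by_contra h2
    nlinarith [mul_le_mul_of_nonneg_left (not_lt.1 h2) hX.le]
  · gcongr
    exact hmean n hn

end WeightedEnergy

/-! ### Combination of the two events and conclusion. -/

theorem tendsto_measure_setOf_and {Ω : ℕ → Type*} [∀ n, MeasurableSpace (Ω n)]
    (μ : ∀ n, MeasureTheory.Measure (Ω n)) [∀ n, MeasureTheory.IsProbabilityMeasure (μ n)]
    {P Q : ∀ n, Ω n → Prop} (hP : Tendsto (fun n => (μ n).real {ω | ¬P n ω}) atTop (𝓝 0))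
    (hQ : Tendsto (fun n => (μ n).real {ω | ¬Q n ω}) atTop (𝓝 0)) :
    Tendsto (fun n => μ n {ω | P n ω ∧ Q n ω}) atTop (𝓝 1) := by
  have hreal : Tendsto (fun n => (μ n).real {ω | P n ω ∧ Q n ω}) atTop (𝓝 1) := by
    have hlow : Tendsto (fun n => 1 - ((μ n).real {ω | ¬P n ω} + (μ n).real {ω | ¬Q n ω})) atTop
        (𝓝 1) := by
      simpa using (hP.add hQ).const_sub 1
    refine tendsto_of_tendsto_of_tendsto_of_le_of_le hlow tendsto_const_nhds (fun n => ?_)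
      fun n => MeasureTheory.measureReal_le_one
    -- Only subadditivity over this cover is used, so the events need not be measurable.
    have hcover : (Set.univ : Set (Ω n)) ⊆
        {ω | P n ω ∧ Q n ω} ∪ ({ω | ¬P n ω} ∪ {ω | ¬Q n ω}) := by
      intro ω _
      simp only [Set.mem_union, Set.mem_ofPred_eq]
      tauto
    have h1 := MeasureTheory.measureReal_mono (μ := μ n) hcover
    rw [MeasureTheory.probReal_univ] at h1
    have h2 := MeasureTheory.measureReal_union_le (μ := μ n) {ω | P n ω ∧ Q n ω}
      ({ω | ¬P n ω} ∪ {ω | ¬Q n ω})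
    have h3 := MeasureTheory.measureReal_union_le (μ := μ n) {ω | ¬P n ω} {ω | ¬Q n ω}
    change 1 - _ ≤ _
    linarith
  have h := ENNReal.tendsto_ofReal hreal
  rw [ENNReal.ofReal_one] at h
  simpa [MeasureTheory.measureReal_def] using h

theorem mainTheorem5 (p : unitInterval) (hp₀ : 0 < p) (hp₁ : p < 1) (ε : ℝ) (hε : 0 < ε) :
    AlmostAllGraphs p fun n G =>
      |matrixEnergy (zagrebMatrix₁ G) (zagrebMatrix₁_isHermitian G) -
          (p : ℝ) * (16 / (3 * Real.pi)) * √((p : ℝ) * (1 - p)) * (n : ℝ) ^ (5 / 2 : ℝ)| ≤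
        ε * ((p : ℝ) * (16 / (3 * Real.pi)) * √((p : ℝ) * (1 - p)) * (n : ℝ) ^ (5 / 2 : ℝ)) ∧
      |matrixEnergy (zagrebMatrix₂ G) (zagrebMatrix₂_isHermitian G) -
          (p : ℝ) ^ 2 * (8 / (3 * Real.pi)) * √((p : ℝ) * (1 - p)) * (n : ℝ) ^ (7 / 2 : ℝ)| ≤
        ε * ((p : ℝ) ^ 2 * (8 / (3 * Real.pi)) * √((p : ℝ) * (1 - p)) *
          (n : ℝ) ^ (7 / 2 : ℝ)) := by
  have hp0 : (0 : ℝ) < p := hp₀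
  have hp1 : (p : ℝ) < 1 := hp₁
  -- With `K = 2` the estimate is `(u + v)² ≤ 2(u² + v²)` for the two degree deviations.
  have h1 := tendsto_binomialRandom_real_weightedEnergy p hp₀ hp₁ (f := fun x y => x + y)
    add_comm (c := fun n => 2 * n * p) (K := fun _ => 2) (B := 1 / p) (by positivity)
    (fun n hn => by positivity) (fun _ => by norm_num) (fun n => by field_simp)
    (fun n x y _ _ _ _ => by nlinarith [sq_nonneg ((x - n * p) - (y - n * p))]) hε
  -- Here `xy - (np)² = (x - np) y + np (y - np)` with `y` and `np` at most `n`, which gives `K²/2 =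
  -- 2n²`.
  have h2 := tendsto_binomialRandom_real_weightedEnergy p hp₀ hp₁ (f := fun x y => x * y)
    mul_comm (c := fun n => (n * p) ^ 2) (K := fun n => 2 * n) (B := 2 / p ^ 2) (by positivity)
    (fun n hn => by positivity) (fun _ => by positivity) (fun n => by field_simp)
    (fun n x y _ _ hy hyn => by
      have e : x * y - (n * p) ^ 2 = (x - n * p) * y + n * p * (y - n * p) := by ring
      have hy2 : y ^ 2 ≤ (n : ℝ) ^ 2 := pow_le_pow_left₀ hy hyn 2
      have hp2 : (n * p : ℝ) ^ 2 ≤ (n : ℝ) ^ 2 :=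
        pow_le_pow_left₀ (by positivity) (mul_le_of_le_one_right (by positivity) hp1.le) 2
      have a1 := mul_le_mul_of_nonneg_left hy2 (sq_nonneg (x - n * p))
      have a2 := mul_le_mul_of_nonneg_left hp2 (sq_nonneg (y - n * p))
      rw [e]
      nlinarith [sq_nonneg ((x - n * p) * y - n * p * (y - n * p))]) hε
  have h5 (n : ℕ) : (n : ℝ) ^ (5 / 2 : ℝ) = n ^ 2 * √n := by
    rcases Nat.eq_zero_or_pos n with rfl | hn
    · norm_num
    rw [show (5 / 2 : ℝ) = (2 : ℕ) + 1 / 2 by norm_num, Real.rpow_add (by exact_mod_cast hn),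
      Real.rpow_natCast, Real.sqrt_eq_rpow]
  have h7 (n : ℕ) : (n : ℝ) ^ (7 / 2 : ℝ) = n ^ 3 * √n := by
    rcases Nat.eq_zero_or_pos n with rfl | hn
    · norm_num
    rw [show (7 / 2 : ℝ) = (3 : ℕ) + 1 / 2 by norm_num, Real.rpow_add (by exact_mod_cast hn),
      Real.rpow_natCast, Real.sqrt_eq_rpow]
  have e1 (n : ℕ) : (p : ℝ) * (16 / (3 * Real.pi)) * √((p : ℝ) * (1 - p)) * (n ^ 2 * √n) =
      8 / (3 * Real.pi) * √((p : ℝ) * (1 - p)) * (2 * n * p * (n * √n)) := by ring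
  have e2 (n : ℕ) : (p : ℝ) ^ 2 * (8 / (3 * Real.pi)) * √((p : ℝ) * (1 - p)) * (n ^ 3 * √n) =
      8 / (3 * Real.pi) * √((p : ℝ) * (1 - p)) * ((n * p) ^ 2 * (n * √n)) := by ring
  unfold AlmostAllGraphs
  simp only [h5, h7, e1, e2]
  exact tendsto_measure_setOf_and _ h1 h2
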